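/- Let $p\ge 1$ and let $a=(a_n)_{n\in\mathbb Z}$, $b=(b_n)_{n\in\mathbb Z}$ be $p$-periodic real sequences ($a_{n+p}=a_n$, $b_{n+p}=b_n$) with $a_n>0$ for all $n$. Let $J$ be the $p$-periodic Jacobi matrix, i.e. the bounded operator on the complex Hilbert space $\ell^2(\mathbb Z)$ given by $$(Jy)_n=a_{n-1}y_{n-1}+b_ny_n+a_ny_{n+1},\qquad n\in\mathbb Z .$$ Then the spectrum of $J$ is real and is the union of $p$ intervals (bands) $\sigma_i=[\lambda_i^-,\lambda_i^+]$, $i=1,\dots,p$, with $\lambda_1^-<\lambda_1^+\le\lambda_2^-<\lambda_2^+\le\dots\le\lambda_p^-<\lambda_p^+$. For every such representation of the spectrum, the lengths $|\gamma_i|=\lambda_{i+1}^--\lambda_i^+$ of the (possibly degenerate) gaps $\gamma_i=(\lambda_i^+,\lambda_{i+1}^-)$, $i=1,\dots,p-1$, satisfy $$\sum_{i=1}^{p-1}|\gamma_i|\ \ge\ \max\Bigl(\max\bigl(4(a_1a_2\cdots a_p)^{1/p},\,2\max_n a_n\bigr)-4\min_n a_n,\ \max_n b_n-\min_n b_n\Bigr).$$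 -/

import Mathlib

/-- The complex Hilbert space `ℓ²(ℤ)`. -/
abbrev L2Z : Type := lp (fun _ : ℤ => ℂ) 2

/-- A `p`-periodic real sequence on `ℤ` is bounded. -/
theorem periodic_bounded {p : ℕ} (hp : 1 ≤ p) {c : ℤ → ℝ} (hc : Function.Periodic c (p : ℤ)) :
    ∃ C : ℝ, 0 ≤ C ∧ ∀ n, |c n| ≤ C := by
  refine ⟨∑ i ∈ Finset.range p, |c i|, Finset.sum_nonneg fun _ _ => abs_nonneg _, fun n => ?_⟩
  have hp0 : (0 : ℤ) < p := by exact_mod_cast hp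
  have h0 := Int.emod_nonneg n hp0.ne'
  have h1 := Int.emod_lt_of_pos n hp0
  have h2 : c n = c ((n % (p : ℤ)).toNat : ℤ) := by
    rw [Int.toNat_of_nonneg h0]
    have h := hc.int_mul (n / (p : ℤ)) (n % (p : ℤ))
    rw [← h]
    congr 1
    have := Int.emod_add_mul_ediv n p
    simp only [Int.cast_id]
    linarith
  rw [h2]
  exact Finset.single_le_sum (f := fun i : ℕ => |c (i : ℤ)|) (fun _ _ => abs_nonneg _)
    (Finset.mem_range.2 (by omega))

/-- Multiplying a shifted `ℓ²` sequence by a bounded sequence gives an `ℓ²` sequence, with a norm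
bound. -/
theorem shiftMul_bound {c : ℤ → ℝ} {C : ℝ} (hC : 0 ≤ C) (hc : ∀ n, |c n| ≤ C) (k : ℤ) (y : L2Z) :
    ∃ h : Memℓp (fun n : ℤ => (c n : ℂ) * y (n + k)) 2,
      ‖(⟨fun n : ℤ => (c n : ℂ) * y (n + k), h⟩ : L2Z)‖ ≤ C * ‖y‖ := by
  have h2 : (0 : ℝ) < (2 : ENNReal).toReal := by norm_num
  have hy : HasSum (fun n : ℤ => ‖y n‖ ^ (2 : ENNReal).toReal) (‖y‖ ^ (2 : ENNReal).toReal) :=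
    lp.hasSum_norm h2 y
  have hy' : HasSum (fun n : ℤ => C ^ (2 : ENNReal).toReal * ‖y (n + k)‖ ^ (2 : ENNReal).toReal)
      (C ^ (2 : ENNReal).toReal * ‖y‖ ^ (2 : ENNReal).toReal) :=
    (((Equiv.addRight k).hasSum_iff (f := fun n : ℤ => ‖y n‖ ^ (2 : ENNReal).toReal)).2 hy).mul_left
      _
  have hle : ∀ n : ℤ, ‖(c n : ℂ) * y (n + k)‖ ^ (2 : ENNReal).toReal ≤
      C ^ (2 : ENNReal).toReal * ‖y (n + k)‖ ^ (2 : ENNReal).toReal := by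
    intro n
    rw [← Real.mul_rpow hC (norm_nonneg _), norm_mul, Complex.norm_real]
    exact Real.rpow_le_rpow (by positivity)
      (mul_le_mul_of_nonneg_right (hc n) (norm_nonneg _)) h2.le
  have hs : Summable fun n : ℤ => ‖(c n : ℂ) * y (n + k)‖ ^ (2 : ENNReal).toReal :=
    Summable.of_nonneg_of_le (fun n => by positivity) hle hy'.summable
  refine ⟨memℓp_gen hs, ?_⟩
  refine lp.norm_le_of_tsum_le h2 (mul_nonneg hC (norm_nonneg _)) ?_
  rw [Real.mul_rpow hC (norm_nonneg _), ← hy'.tsum_eq]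
  exact hs.tsum_le_tsum hle hy'.summable

/-- The right-hand side of the Jacobi difference expression is in `ℓ²`, with a norm bound. -/
theorem jacobi_bound {p : ℕ} (hp : 1 ≤ p) {a b : ℤ → ℝ}
    (ha : Function.Periodic a (p : ℤ)) (hb : Function.Periodic b (p : ℤ)) :
    ∃ D : ℝ, ∀ y : L2Z, ∃ h : Memℓp (fun n : ℤ =>
        (a (n - 1) : ℂ) * y (n - 1) + (b n : ℂ) * y n + (a n : ℂ) * y (n + 1)) 2,
      ‖(⟨_, h⟩ : L2Z)‖ ≤ D * ‖y‖ := by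
  obtain ⟨A, hA, hA'⟩ := periodic_bounded hp ha
  obtain ⟨B, hB, hB'⟩ := periodic_bounded hp hb
  refine ⟨A + B + A, fun y => ?_⟩
  obtain ⟨m1, n1⟩ := shiftMul_bound (c := fun n => a (n - 1)) hA (fun n => hA' (n - 1)) (-1) y
  obtain ⟨m2, n2⟩ := shiftMul_bound hB hB' 0 y
  obtain ⟨m3, n3⟩ := shiftMul_bound hA hA' 1 y
  have e : (fun n : ℤ =>
      (a (n - 1) : ℂ) * y (n - 1) + (b n : ℂ) * y n + (a n : ℂ) * y (n + 1)) =
      (fun n : ℤ => (a (n - 1) : ℂ) * y (n + -1)) + (fun n : ℤ => (b n : ℂ) * y (n + 0)) +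
        (fun n : ℤ => (a n : ℂ) * y (n + 1)) := by
    funext n
    simp [sub_eq_add_neg]
  have h : Memℓp (fun n : ℤ =>
      (a (n - 1) : ℂ) * y (n - 1) + (b n : ℂ) * y n + (a n : ℂ) * y (n + 1)) 2 := by
    rw [e]
    exact (m1.add m2).add m3
  refine ⟨h, ?_⟩
  have e' : (⟨_, h⟩ : L2Z) = (⟨_, m1⟩ : L2Z) + (⟨_, m2⟩ : L2Z) + (⟨_, m3⟩ : L2Z) :=
    Subtype.ext e
  rw [e', add_mul, add_mul]
  exact (norm_add₃_le).trans (add_le_add (add_le_add n1 n2) n3)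

/-- The `p`-periodic Jacobi matrix `J(a, b)`, as a bounded operator on `ℓ²(ℤ)`:
`(J y) n = a (n-1) y (n-1) + b n y n + a n y (n+1)`. -/
noncomputable def jacobi {p : ℕ} (hp : 1 ≤ p) {a b : ℤ → ℝ}
    (ha : Function.Periodic a (p : ℤ)) (hb : Function.Periodic b (p : ℤ)) : L2Z →L[ℂ] L2Z :=
  LinearMap.mkContinuousOfExistsBound
    { toFun := fun y =>
        ⟨fun n : ℤ => (a (n - 1) : ℂ) * y (n - 1) + (b n : ℂ) * y n + (a n : ℂ) * y (n + 1),
          ((jacobi_bound hp ha hb).choose_spec y).choose⟩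
      map_add' := fun y z => by
        ext n
        simp only [lp.coeFn_add, Pi.add_apply]
        ring
      map_smul' := fun t y => by
        ext n
        simp only [lp.coeFn_smul, Pi.smul_apply, smul_eq_mul, RingHom.id_apply]
        ring }
    ⟨(jacobi_bound hp ha hb).choose, fun y =>
      ((jacobi_bound hp ha hb).choose_spec y).choose_spec⟩

theorem jacobi_apply {p : ℕ} (hp : 1 ≤ p) {a b : ℤ → ℝ}
    (ha : Function.Periodic a (p : ℤ)) (hb : Function.Periodic b (p : ℤ)) (y : L2Z) (n : ℤ) :
    jacobi hp ha hb y n =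
      (a (n - 1) : ℂ) * y (n - 1) + (b n : ℂ) * y n + (a n : ℂ) * y (n + 1) := rfl

/-- `IsBandDecomposition T p l u`: the spectrum of `T` is the union of the `p` bands
`[l i, u i]`, `i = 0, …, p - 1`, which are nondegenerate intervals of the real line listed from left
to right; two consecutive bands may touch (then the gap between them is degenerate), but do not
overlap. Only the values `l i`, `u i` with `i < p` matter. -/
structure IsBandDecomposition (T : L2Z →L[ℂ] L2Z) (p : ℕ) (l u : ℕ → ℝ) : Prop where
  lt : ∀ i < p, l i < u i
  le : ∀ i, i + 1 < p → u i ≤ l (i + 1)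
  spectrum_eq : spectrum ℂ T = ((↑) : ℝ → ℂ) '' ⋃ i ∈ Finset.range p, Set.Icc (l i) (u i)

/-- The `i`-th gap, between the `i`-th band and the next one (empty if it is degenerate). -/
def bandGap (l u : ℕ → ℝ) (i : ℕ) : Set ℝ := Set.Ioo (u i) (l (i + 1))

/-! By Floquet theory the problem becomes one about Hermitian matrices. A sequence with `y (n + p) =
z * y n` and `‖z‖ = 1` is determined by its values over one period, and the Jacobi expression acts
on these values as the symmetric operator `floquet a b p z`. The spectrum on `ℓ²(ℤ)` is the union
over `z` of the eigenvalues of these operators: truncated Bloch solutions are approximate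
eigenvectors, and Plancherel's identity bounds the resolvent elsewhere (`spectrum_jacobi_eq`).

For `z = exp (θ * I)` with `θ` in `[0, π]`, the `i`-th eigenvalue is continuous in `θ`, and
injective because Wronskians are conserved (`IsBloch.multiplier_eq_or_mul_eq_one`). Its range is
thus a nondegenerate band whose edges are the `i`-th eigenvalues at `z = 1` and `z = -1`.
Restricting to sequences that vanish at one site removes the dependence on `z`, so the eigenvalues
`μ i` of the restriction interlace all the Floquet eigenvalues and lie in the closed gaps
(`exists_interlacing`).

The sum of the gaps is the spread of the spectrum minus the total band length. The total band length
is at most `4 * a s` for each `s`, because periodic and antiperiodic conditions differ in a single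
bond (`sum_abs_floquet_sub_le`). Test sequences show that the spread is at least four times the
geometric mean of `a`, and at least `2 * a s`. For the bound on `b`, the restriction at site `s` has
trace `∑ b - b s`; for two sites the eigenvalues share the same closed gaps, so the traces differ by
at most the sum of the gaps. -/

open Module

/-! ### Min-max principles for symmetric operators in finite dimension -/

section Eigenvalues

variable {E F : Type*} [NormedAddCommGroup E] [InnerProductSpace ℂ E] [FiniteDimensional ℂ E]
  [NormedAddCommGroup F] [InnerProductSpace ℂ F] [FiniteDimensional ℂ F]

/-- The eigenvalues of a symmetric operator in increasing order, counted with multiplicity and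
indexed from `0`; the value is `0` for an index out of range. -/
noncomputable def ascEigenvalue (T : E →ₗ[ℂ] E) (i : ℕ) : ℝ :=
  open Classical in
  if h : T.IsSymmetric ∧ i < finrank ℂ E then
    h.1.eigenvalues rfl ⟨finrank ℂ E - 1 - i, by omega⟩ else 0

/-- `LinearMap.IsSymmetric.eigenvalues` is decreasing, hence the reversed index here and the use of
`Ici` for the small eigenvalues below. -/
theorem ascEigenvalue_eq {T : E →ₗ[ℂ] E} (hT : T.IsSymmetric) (j : Fin (finrank ℂ E)) :
    hT.eigenvalues rfl j = ascEigenvalue T (finrank ℂ E - 1 - j) := by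
  have hj := j.2
  rw [ascEigenvalue, dif_pos ⟨hT, by omega⟩]
  congr 1
  ext
  simp only
  omega

theorem exists_ascEigenvalue_eigenvector {T : E →ₗ[ℂ] E} (hT : T.IsSymmetric) {i : ℕ}
    (hi : i < finrank ℂ E) : ∃ v, v ≠ 0 ∧ T v = (ascEigenvalue T i : ℂ) • v := by
  obtain ⟨v, hv⟩ := (hT.hasEigenvalue_eigenvalues rfl
    ⟨finrank ℂ E - 1 - i, by omega⟩).exists_hasEigenvector
  refine ⟨v, hv.2, ?_⟩
  rw [ascEigenvalue, dif_pos ⟨hT, hi⟩]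
  exact hv.apply_eq_smul

theorem exists_ascEigenvalue_eq {T : E →ₗ[ℂ] E} (hT : T.IsSymmetric) {c : ℝ} {v : E}
    (hv : v ≠ 0) (h : T v = (c : ℂ) • v) : ∃ i < finrank ℂ E, ascEigenvalue T i = c := by
  obtain ⟨j, hj⟩ := hT.exists_eigenvalues_eq rfl
    (Module.End.hasEigenvalue_of_hasEigenvector (Module.End.hasEigenvector_iff.2
      ⟨Module.End.mem_eigenspace_iff.2 h, hv⟩))
  have := j.2
  refine ⟨_, by omega, (ascEigenvalue_eq hT j).symm.trans ?_⟩
  exact Complex.ofReal_injective hj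

theorem sum_ascEigenvalue {T : E →ₗ[ℂ] E} (hT : T.IsSymmetric) {n : ℕ} (hn : finrank ℂ E = n) :
    ∑ i ∈ Finset.range n, ascEigenvalue T i = (LinearMap.trace ℂ E T).re := by
  subst hn
  have h := hT.re_trace_eq_sum_eigenvalues rfl
  simp only [RCLike.re_to_complex] at h
  rw [h, ← Finset.sum_range_reflect, Finset.sum_range]
  exact Finset.sum_congr rfl fun j _ => (ascEigenvalue_eq hT j).symm

theorem re_inner_eq_sum_eigenvalues {T : E →ₗ[ℂ] E} (hT : T.IsSymmetric) (v : E) :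
    (inner ℂ (T v) v).re =
      ∑ j, hT.eigenvalues rfl j * ‖(hT.eigenvectorBasis rfl).repr v j‖ ^ 2 := by
  rw [← (hT.eigenvectorBasis rfl).repr.inner_map_map, PiLp.inner_apply, Complex.re_sum]
  refine Finset.sum_congr rfl fun j _ => ?_
  rw [hT.eigenvectorBasis_apply_self_apply, ← smul_eq_mul, inner_smul_left, inner_self_eq_norm_sq_to_K]
  simp [← Complex.ofReal_pow]

theorem norm_sq_eq_sum_eigenvectorBasis {T : E →ₗ[ℂ] E} (hT : T.IsSymmetric) (v : E) :
    ‖v‖ ^ 2 = ∑ j, ‖(hT.eigenvectorBasis rfl).repr v j‖ ^ 2 := by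
  rw [← EuclideanSpace.norm_sq_eq, LinearIsometryEquiv.norm_map]

/-- Spans of eigenvectors supply the test subspaces of the min-max argument: on them the Rayleigh
quotient involves only the eigenvalues indexed by `s`. -/
theorem exists_spectral_subspace {T : E →ₗ[ℂ] E} (hT : T.IsSymmetric)
    (s : Finset (Fin (finrank ℂ E))) : ∃ W : Submodule ℂ E, finrank ℂ W = s.card ∧
      ∀ v ∈ W, ∀ j ∉ s, (hT.eigenvectorBasis rfl).repr v j = 0 := by
  set B := (hT.eigenvectorBasis rfl) with hB
  refine ⟨Submodule.span ℂ (B.toBasis '' s), ?_, fun v hv j hj => ?_⟩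
  · classical
    rw [← Finset.coe_image, finrank_span_finset_eq_card, Finset.card_image_of_injective _
      B.toBasis.injective]
    rw [Finset.coe_image]
    exact (B.toBasis.linearIndependent.linearIndepOn _).id_image
  · rw [B.toBasis.mem_span_image] at hv
    have h : B.toBasis.repr v j = 0 := by
      by_contra h0
      exact hj (hv (Finsupp.mem_support_iff.2 h0))
    simpa using h

theorem exists_subspace_inner_le {T : E →ₗ[ℂ] E} (hT : T.IsSymmetric) {i : ℕ}
    (hi : i < finrank ℂ E) : ∃ W : Submodule ℂ E, finrank ℂ W = i + 1 ∧
      ∀ v ∈ W, (inner ℂ (T v) v).re ≤ ascEigenvalue T i * ‖v‖ ^ 2 := by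
  obtain ⟨W, hW, h⟩ := exists_spectral_subspace hT (Finset.Ici ⟨finrank ℂ E - 1 - i, by omega⟩)
  refine ⟨W, by rw [hW, Fin.card_Ici]; simp only; omega, fun v hv => ?_⟩
  rw [re_inner_eq_sum_eigenvalues hT, norm_sq_eq_sum_eigenvectorBasis hT, Finset.mul_sum]
  refine Finset.sum_le_sum fun j _ => ?_
  by_cases hj : j ∈ Finset.Ici ⟨finrank ℂ E - 1 - i, by omega⟩
  · refine mul_le_mul_of_nonneg_right ?_ (sq_nonneg _)
    rw [ascEigenvalue, dif_pos ⟨hT, hi⟩]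
    exact hT.eigenvalues_antitone _ (Finset.mem_Ici.1 hj)
  · simp [h v hv j hj]

theorem exists_subspace_le_inner {T : E →ₗ[ℂ] E} (hT : T.IsSymmetric) {i : ℕ}
    (hi : i < finrank ℂ E) : ∃ W : Submodule ℂ E, finrank ℂ W = finrank ℂ E - i ∧
      ∀ v ∈ W, ascEigenvalue T i * ‖v‖ ^ 2 ≤ (inner ℂ (T v) v).re := by
  obtain ⟨W, hW, h⟩ := exists_spectral_subspace hT (Finset.Iic ⟨finrank ℂ E - 1 - i, by omega⟩)
  refine ⟨W, by rw [hW, Fin.card_Iic]; simp only; omega, fun v hv => ?_⟩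
  rw [re_inner_eq_sum_eigenvalues hT, norm_sq_eq_sum_eigenvectorBasis hT, Finset.mul_sum]
  refine Finset.sum_le_sum fun j _ => ?_
  by_cases hj : j ∈ Finset.Iic ⟨finrank ℂ E - 1 - i, by omega⟩
  · refine mul_le_mul_of_nonneg_right ?_ (sq_nonneg _)
    rw [ascEigenvalue, dif_pos ⟨hT, hi⟩]
    exact hT.eigenvalues_antitone _ (Finset.mem_Iic.1 hj)
  · simp [h v hv j hj]

theorem exists_ne_zero_mem_inf {V W : Submodule ℂ E}
    (h : finrank ℂ E < finrank ℂ V + finrank ℂ W) : ∃ v ∈ V, v ∈ W ∧ v ≠ 0 := by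
  have h1 := Submodule.finrank_sup_add_finrank_inf_eq V W
  have h2 := Submodule.finrank_le (V ⊔ W)
  have h3 : V ⊓ W ≠ ⊥ := by
    intro h0
    rw [h0, finrank_bot] at h1
    omega
  obtain ⟨v, hv, h0⟩ := Submodule.exists_mem_ne_zero_of_ne_bot h3
  exact ⟨v, hv.1, hv.2, h0⟩

/-- Comparison of eigenvalues along an isometric embedding `e`, upper bound. -/
theorem ascEigenvalue_le_of_inner_le {T : E →ₗ[ℂ] E} (hT : T.IsSymmetric) {S : F →ₗ[ℂ] F}
    (hS : S.IsSymmetric) (e : F →ₗᵢ[ℂ] E) {ε : ℝ}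
    (h : ∀ v, (inner ℂ (T (e v)) (e v)).re ≤ (inner ℂ (S v) v).re + ε * ‖v‖ ^ 2) {i : ℕ}
    (hi : i < finrank ℂ F) : ascEigenvalue T i ≤ ascEigenvalue S i + ε := by
  have hd : finrank ℂ F ≤ finrank ℂ E := LinearMap.finrank_le_finrank_of_injective
    (f := e.toLinearMap) e.injective
  obtain ⟨V, hV, hV'⟩ := exists_subspace_inner_le hS hi
  obtain ⟨W, hW, hW'⟩ := exists_subspace_le_inner hT (hi.trans_le hd)
  -- The dimensions `i + 1` and `finrank ℂ E - i` exceed `finrank ℂ E` by one in total, so the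
  -- subspaces share a nonzero vector.
  obtain ⟨v, hv, hv', h0⟩ := exists_ne_zero_mem_inf (V := V.map e.toLinearMap) (W := W) (by
    rw [← (V.equivMapOfInjective e.toLinearMap e.injective).finrank_eq, hV, hW]; omega)
  obtain ⟨w, hw, rfl⟩ := hv
  have h1 := hW' _ hv'
  have h2 := hV' w hw
  have h3 := h w
  have h4 : 0 < ‖w‖ ^ 2 := by
    have : w ≠ 0 := by rintro rfl; simp at h0
    positivity
  simp only [LinearIsometry.coe_toLinearMap, LinearIsometry.norm_map] at h1
  refine le_of_mul_le_mul_right ?_ h4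
  linarith

/-- Comparison of eigenvalues along an isometric embedding `e`, lower bound. -/
theorem ascEigenvalue_le_of_le_inner {T : E →ₗ[ℂ] E} (hT : T.IsSymmetric) {S : F →ₗ[ℂ] F}
    (hS : S.IsSymmetric) (e : F →ₗᵢ[ℂ] E)
    (h : ∀ v, (inner ℂ (S v) v).re ≤ (inner ℂ (T (e v)) (e v)).re) {i : ℕ}
    (hi : i < finrank ℂ F) :
    ascEigenvalue S i ≤ ascEigenvalue T (i + (finrank ℂ E - finrank ℂ F)) := by
  have hd : finrank ℂ F ≤ finrank ℂ E := LinearMap.finrank_le_finrank_of_injective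
    (f := e.toLinearMap) e.injective
  obtain ⟨V, hV, hV'⟩ := exists_subspace_le_inner hS hi
  obtain ⟨W, hW, hW'⟩ := exists_subspace_inner_le hT
    (i := i + (finrank ℂ E - finrank ℂ F)) (by omega)
  obtain ⟨v, hv, hv', h0⟩ := exists_ne_zero_mem_inf (V := V.map e.toLinearMap) (W := W) (by
    rw [← (V.equivMapOfInjective e.toLinearMap e.injective).finrank_eq, hV, hW]; omega)
  obtain ⟨w, hw, rfl⟩ := hv
  have h1 := hW' _ hv'
  have h2 := hV' w hw
  have h3 := h w
  have h4 : 0 < ‖w‖ ^ 2 := by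
    have : w ≠ 0 := by rintro rfl; simp at h0
    positivity
  simp only [LinearIsometry.coe_toLinearMap, LinearIsometry.norm_map] at h1
  refine le_of_mul_le_mul_right ?_ h4
  linarith

theorem ascEigenvalue_le_add {A B : E →ₗ[ℂ] E} (hA : A.IsSymmetric) (hB : B.IsSymmetric) {ε : ℝ}
    (h : ∀ v, (inner ℂ (A v) v).re ≤ (inner ℂ (B v) v).re + ε * ‖v‖ ^ 2) {i : ℕ}
    (hi : i < finrank ℂ E) : ascEigenvalue A i ≤ ascEigenvalue B i + ε :=
  ascEigenvalue_le_of_inner_le hA hB LinearIsometry.id h hi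

/-- If `A ≤ C` and `B ≤ C`, then the total distance of the eigenvalues of `A` and `B` is at most
`tr (C - A) + tr (C - B)`. -/
theorem sum_abs_ascEigenvalue_sub_le {A B C : E →ₗ[ℂ] E} (hA : A.IsSymmetric)
    (hB : B.IsSymmetric) (hC : C.IsSymmetric)
    (hAC : ∀ v, (inner ℂ (A v) v).re ≤ (inner ℂ (C v) v).re)
    (hBC : ∀ v, (inner ℂ (B v) v).re ≤ (inner ℂ (C v) v).re) {n : ℕ} (hn : finrank ℂ E = n) :
    ∑ i ∈ Finset.range n, |ascEigenvalue A i - ascEigenvalue B i| ≤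
      (LinearMap.trace ℂ E (C - A)).re + (LinearMap.trace ℂ E (C - B)).re := by
  simp only [map_sub, Complex.sub_re]
  rw [← sum_ascEigenvalue hA hn, ← sum_ascEigenvalue hB hn, ← sum_ascEigenvalue hC hn,
    ← Finset.sum_sub_distrib, ← Finset.sum_sub_distrib, ← Finset.sum_add_distrib]
  -- Termwise, two numbers below a third differ by at most the sum of their distances to it; the
  -- third is the eigenvalue of `C`.
  refine Finset.sum_le_sum fun i hi => ?_
  have hi' : i < finrank ℂ E := by rw [hn]; exact Finset.mem_range.1 hi
  have h1 := ascEigenvalue_le_add (ε := 0) hA hC (by simpa using hAC) hi'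
  have h2 := ascEigenvalue_le_add (ε := 0) hB hC (by simpa using hBC) hi'
  rw [abs_le]
  constructor <;> linarith

theorem ascEigenvalue_zero_mul_le {T : E →ₗ[ℂ] E} (hT : T.IsSymmetric) (h0 : 0 < finrank ℂ E)
    (v : E) : ascEigenvalue T 0 * ‖v‖ ^ 2 ≤ (inner ℂ (T v) v).re := by
  obtain ⟨W, hW, h⟩ := exists_subspace_le_inner hT h0
  exact h v (Submodule.eq_top_of_finrank_eq (by simpa using hW) ▸ Submodule.mem_top)

theorem le_ascEigenvalue_last_mul {T : E →ₗ[ℂ] E} (hT : T.IsSymmetric) {n : ℕ}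
    (hn : finrank ℂ E = n + 1) (v : E) :
    (inner ℂ (T v) v).re ≤ ascEigenvalue T n * ‖v‖ ^ 2 := by
  obtain ⟨W, hW, h⟩ := exists_subspace_inner_le hT (i := n) (by omega)
  exact h v (Submodule.eq_top_of_finrank_eq (hW.trans hn.symm) ▸ Submodule.mem_top)

/-- The resolvent bound on one Floquet fibre, to be integrated over all multipliers later. -/
theorem norm_sub_smul_ge {T : E →ₗ[ℂ] E} (hT : T.IsSymmetric) {c δ : ℝ} (hδ : 0 ≤ δ)
    (h : ∀ i < finrank ℂ E, δ ≤ |ascEigenvalue T i - c|) (v : E) :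
    δ ^ 2 * ‖v‖ ^ 2 ≤ ‖T v - (c : ℂ) • v‖ ^ 2 := by
  rw [norm_sq_eq_sum_eigenvectorBasis hT, norm_sq_eq_sum_eigenvectorBasis hT, Finset.mul_sum]
  refine Finset.sum_le_sum fun j _ => ?_
  have e : (hT.eigenvectorBasis rfl).repr (T v - (c : ℂ) • v) j =
      ((hT.eigenvalues rfl j - c : ℝ) : ℂ) * (hT.eigenvectorBasis rfl).repr v j := by
    rw [map_sub, map_smul, PiLp.sub_apply, hT.eigenvectorBasis_apply_self_apply, PiLp.smul_apply]
    push_cast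
    rw [smul_eq_mul, sub_mul]
    rfl
  rw [e, norm_mul, mul_pow, Complex.norm_real, Real.norm_eq_abs]
  have hj := j.2
  have := h (finrank ℂ E - 1 - j) (by omega)
  rw [← ascEigenvalue_eq hT] at this
  gcongr

end Eigenvalues

/-! ### Sums over one period -/

section PeriodicSums

theorem Function.Periodic.sum_range_add {M : Type*} [AddCommGroup M] {p : ℕ} {f : ℤ → M}
    (hf : Function.Periodic f (p : ℤ)) (s : ℤ) :
    ∑ n ∈ Finset.range p, f (n + s) = ∑ n ∈ Finset.range p, f n := by
  have step : ∀ s : ℤ, ∑ n ∈ Finset.range p, f (n + (s + 1)) = ∑ n ∈ Finset.range p, f (n + s) := by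
    intro s
    have h1 := Finset.sum_range_succ (fun n : ℕ => f (n + s)) p
    have h2 := Finset.sum_range_succ' (fun n : ℕ => f (n + s)) p
    have h3 : f ((p : ℤ) + s) = f ((0 : ℕ) + s) := by
      rw [add_comm, hf]; simp
    rw [h3, h2, add_left_inj] at h1
    rw [← h1]
    refine Finset.sum_congr rfl fun n _ => ?_
    congr 1
    push_cast
    ring
  induction s using Int.induction_on with
  | zero => simp
  | succ k ih => rw [step, ih]
  | pred k ih => rw [← ih, ← step]; simp

end PeriodicSums

/-! ### Bloch sequences, Floquet operators and the Wronskian -/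

section Bloch

/-- The Jacobi difference expression on arbitrary two-sided sequences. -/
def jacobiExpr (a b : ℤ → ℝ) (y : ℤ → ℂ) (n : ℤ) : ℂ :=
  (a (n - 1) : ℂ) * y (n - 1) + (b n : ℂ) * y n + (a n : ℂ) * y (n + 1)

/-- Sequences that are multiplied by `z` when shifted by a period `p`. -/
def IsBloch (p : ℕ) (z : ℂ) (y : ℤ → ℂ) : Prop := ∀ n, y (n + p) = z * y n

/-- The Bloch sequence with multiplier `z` and prescribed values on `0, …, p - 1`. -/
noncomputable def blochExt {p : ℕ} [NeZero p] (z : ℂ) (v : EuclideanSpace ℂ (Fin p)) (n : ℤ) : ℂ :=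
  z ^ (n / (p : ℤ)) * v (Fin.ofNat p (n % p).toNat)

variable {p : ℕ} {a b : ℤ → ℝ} {z w : ℂ} {x y : ℤ → ℂ}

theorem IsBloch.add_mul_period (hz : z ≠ 0) (hy : IsBloch p z y) (n k : ℤ) :
    y (n + k * p) = z ^ k * y n := by
  induction k using Int.induction_on with
  | zero => simp
  | succ k ih =>
    rw [zpow_add_one₀ hz, mul_right_comm, ← ih, add_one_mul, ← add_assoc, hy, mul_comm]
  | pred k ih =>
    have h := hy (n + (-k - 1) * p)
    rw [show n + (-(k : ℤ) - 1) * p + p = n + -k * p by ring, ih] at h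
    rw [zpow_sub_one₀ hz, mul_right_comm, h]
    field_simp

theorem IsBloch.isBloch_jacobiExpr (ha : Function.Periodic a (p : ℤ))
    (hb : Function.Periodic b (p : ℤ))
    (hy : IsBloch p z y) : IsBloch p z (jacobiExpr a b y) := by
  intro n
  have h1 := hy (n - 1)
  have h2 := hy (n + 1)
  rw [show n - 1 + (p : ℤ) = n + p - 1 by ring] at h1
  rw [show n + 1 + (p : ℤ) = n + p + 1 by ring] at h2
  have h3 := ha (n - 1)
  rw [show n - 1 + (p : ℤ) = n + p - 1 by ring] at h3
  simp only [jacobiExpr, h1, h2, h3, ha n, hb n, hy n]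
  ring

theorem IsBloch.norm_periodic (hz : ‖z‖ = 1) (hy : IsBloch p z y) :
    Function.Periodic (fun n => ‖y n‖) (p : ℤ) := by
  intro n
  simp [hy n, hz]

theorem IsBloch.shift (hy : IsBloch p z y) (s : ℤ) : IsBloch p z fun n => y (n + s) := by
  intro n
  simp only
  rw [add_right_comm, hy]

section Ext

variable [NeZero p]

theorem blochExt_isBloch (hz : z ≠ 0) (v : EuclideanSpace ℂ (Fin p)) :
    IsBloch p z (blochExt z v) := by
  intro n
  have hp : (p : ℤ) ≠ 0 := by exact_mod_cast NeZero.ne p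
  simp only [blochExt]
  rw [Int.add_emod_right, Int.add_ediv_of_dvd_right (dvd_refl _), Int.ediv_self hp,
    zpow_add_one₀ hz]
  ring

@[simp]
theorem blochExt_natCast (z : ℂ) (v : EuclideanSpace ℂ (Fin p)) (i : Fin p) :
    blochExt z v ((i : ℕ) : ℤ) = v i := by
  have h1 : ((i : ℕ) : ℤ) / (p : ℤ) = 0 := by
    apply Int.ediv_eq_zero_of_lt <;> have := i.2 <;> omega
  have h2 : ((i : ℕ) : ℤ) % (p : ℤ) = (i : ℕ) := by
    apply Int.emod_eq_of_lt <;> have := i.2 <;> omega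
  rw [blochExt, h1, h2]
  simp

theorem IsBloch.eq_of_forall_fin (hz : z ≠ 0) (hx : IsBloch p z x) (hy : IsBloch p z y)
    (h : ∀ i : Fin p, x ((i : ℕ) : ℤ) = y ((i : ℕ) : ℤ)) : x = y := by
  funext n
  have hp : (0 : ℤ) < p := by exact_mod_cast NeZero.pos p
  have h0 := Int.emod_nonneg n hp.ne'
  have h1 := Int.emod_lt_of_pos n hp
  have e : n = n % p + n / p * p := by rw [mul_comm]; exact (Int.emod_add_mul_ediv n p).symm
  have h2 := h ⟨(n % p).toNat, by omega⟩
  simp only [Int.toNat_of_nonneg h0] at h2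
  rw [e, hx.add_mul_period hz, hy.add_mul_period hz, h2]

theorem IsBloch.blochExt_toLp (hz : z ≠ 0) (hy : IsBloch p z y) :
    blochExt z (WithLp.toLp 2 fun i : Fin p => y ((i : ℕ) : ℤ)) = y :=
  (blochExt_isBloch hz _).eq_of_forall_fin hz hy fun i => by simp

theorem blochExt_add (z : ℂ) (v w : EuclideanSpace ℂ (Fin p)) (n : ℤ) :
    blochExt z (v + w) n = blochExt z v n + blochExt z w n := by
  simp [blochExt, mul_add]

theorem blochExt_smul (z c : ℂ) (v : EuclideanSpace ℂ (Fin p)) (n : ℤ) :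
    blochExt z (c • v) n = c * blochExt z v n := by
  simp [blochExt, mul_left_comm]

theorem norm_sq_eq_sum_blochExt (z : ℂ) (v : EuclideanSpace ℂ (Fin p)) :
    ‖v‖ ^ 2 = ∑ n ∈ Finset.range p, ‖blochExt z v n‖ ^ 2 := by
  rw [EuclideanSpace.norm_sq_eq, Finset.sum_range]
  simp

/-- The Floquet operator: the action of the Jacobi expression on Bloch sequences with
multiplier `z`. -/
noncomputable def floquet (a b : ℤ → ℝ) (p : ℕ) [NeZero p] (z : ℂ) :
    EuclideanSpace ℂ (Fin p) →ₗ[ℂ] EuclideanSpace ℂ (Fin p) where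
  toFun v := WithLp.toLp 2 fun i => jacobiExpr a b (blochExt z v) ((i : ℕ) : ℤ)
  map_add' v w := by
    ext i
    simp only [jacobiExpr, blochExt_add, PiLp.add_apply]
    ring
  map_smul' c v := by
    ext i
    simp only [jacobiExpr, blochExt_smul, PiLp.smul_apply, smul_eq_mul, RingHom.id_apply]
    ring

theorem blochExt_floquet (ha : Function.Periodic a (p : ℤ)) (hb : Function.Periodic b (p : ℤ))
    (hz : z ≠ 0) (v : EuclideanSpace ℂ (Fin p)) :
    blochExt z (floquet a b p z v) = jacobiExpr a b (blochExt z v) :=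
  ((blochExt_isBloch hz v).isBloch_jacobiExpr ha hb).blochExt_toLp hz

theorem ne_zero_of_norm_one (hz : ‖z‖ = 1) : z ≠ 0 := by
  rintro rfl
  simp at hz

theorem conj_mul_self_of_norm_one (hz : ‖z‖ = 1) : (starRingEnd ℂ) z * z = 1 := by
  rw [← Complex.normSq_eq_conj_mul_self, Complex.normSq_eq_norm_sq, hz]
  simp

/-- Summation by parts over a period. There is no boundary term because `conj z * z = 1` makes the
coupling term `f` periodic; the result is visibly Hermitian. -/
theorem inner_floquet_left (ha : Function.Periodic a (p : ℤ)) (hz : ‖z‖ = 1)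
    (v w : EuclideanSpace ℂ (Fin p)) :
    inner ℂ (floquet a b p z v) w = ∑ n ∈ Finset.range p,
      ((b n : ℂ) * ((starRingEnd ℂ) (blochExt z v n) * blochExt z w n) +
        (a n : ℂ) * ((starRingEnd ℂ) (blochExt z v n) * blochExt z w (n + 1) +
          (starRingEnd ℂ) (blochExt z v (n + 1)) * blochExt z w n)) := by
  have hz0 := ne_zero_of_norm_one hz
  have hv := blochExt_isBloch hz0 v
  have hw := blochExt_isBloch hz0 w
  set f : ℤ → ℂ := fun n =>
    (a n : ℂ) * ((starRingEnd ℂ) (blochExt z v n) * blochExt z w (n + 1)) with hf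
  have hper : Function.Periodic f (p : ℤ) := by
    intro n
    simp only [hf]
    rw [add_right_comm, hv, hw, ha, map_mul]
    linear_combination (a n : ℂ) * (starRingEnd ℂ) (blochExt z v n) * blochExt z w (n + 1) *
      conj_mul_self_of_norm_one hz
  have hs := hper.sum_range_add (-1)
  have e : ∀ n : ℤ, f (n + -1) =
      (a (n - 1) : ℂ) * ((starRingEnd ℂ) (blochExt z v (n - 1)) * blochExt z w n) := by
    intro n
    simp only [hf]
    rw [show n + -1 + 1 = n by ring, show n + -1 = n - 1 by ring]
  simp only [e] at hs
  have h1 : inner ℂ (floquet a b p z v) w = ∑ n ∈ Finset.range p,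
      (starRingEnd ℂ) (jacobiExpr a b (blochExt z v) n) * blochExt z w n := by
    rw [Finset.sum_range, PiLp.inner_apply]
    refine Finset.sum_congr rfl fun i _ => ?_
    rw [blochExt_natCast]
    simp [floquet, mul_comm]
  rw [h1]
  simp only [mul_add, Finset.sum_add_distrib]
  simp only [hf] at hs
  rw [← hs]
  simp only [← Finset.sum_add_distrib]
  refine Finset.sum_congr rfl fun n _ => ?_
  simp only [jacobiExpr, map_add, map_mul, Complex.conj_ofReal]
  ring

theorem floquet_isSymmetric (ha : Function.Periodic a (p : ℤ)) (hz : ‖z‖ = 1) :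
    (floquet a b p z).IsSymmetric := by
  intro v w
  rw [← inner_conj_symm v, inner_floquet_left ha hz, inner_floquet_left ha hz, map_sum]
  refine Finset.sum_congr rfl fun n _ => ?_
  simp only [map_add, map_mul, Complex.conj_ofReal, Complex.conj_conj]
  ring

/-- The energy density of a sequence with respect to the Jacobi expression. -/
noncomputable def jacobiEnergy (a b : ℤ → ℝ) (y : ℤ → ℂ) (n : ℤ) : ℝ :=
  b n * ‖y n‖ ^ 2 + 2 * a n * ((starRingEnd ℂ) (y n) * y (n + 1)).re

theorem re_inner_floquet (ha : Function.Periodic a (p : ℤ)) (hz : ‖z‖ = 1)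
    (v : EuclideanSpace ℂ (Fin p)) :
    (inner ℂ (floquet a b p z v) v).re =
      ∑ n ∈ Finset.range p, jacobiEnergy a b (blochExt z v) n := by
  rw [inner_floquet_left ha hz, Complex.re_sum]
  refine Finset.sum_congr rfl fun n _ => ?_
  simp only [jacobiEnergy, Complex.sq_norm, Complex.normSq_apply, Complex.add_re, Complex.mul_re,
    Complex.add_im, Complex.mul_im, Complex.conj_re, Complex.conj_im, Complex.ofReal_re,
    Complex.ofReal_im]
  ring

end Ext

theorem IsBloch.jacobiEnergy_periodic (ha : Function.Periodic a (p : ℤ))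
    (hb : Function.Periodic b (p : ℤ)) (hz : ‖z‖ = 1) (hy : IsBloch p z y) :
    Function.Periodic (jacobiEnergy a b y) (p : ℤ) := by
  intro n
  have h : (starRingEnd ℂ) (y (n + p)) * y (n + p + 1) = (starRingEnd ℂ) (y n) * y (n + 1) := by
    rw [add_right_comm, hy, hy, map_mul]
    linear_combination (starRingEnd ℂ) (y n) * y (n + 1) * conj_mul_self_of_norm_one hz
  rw [jacobiEnergy, jacobiEnergy, h, ha, hb, hy]
  simp [hz]

/-! ### Solutions of the eigenvalue equation -/

/-- As no `a n` vanishes, the three-term recursion can be solved in both directions from two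
adjacent values. -/
theorem eq_zero_of_jacobiExpr_eq (hpos : ∀ n, 0 < a n) {c : ℂ}
    (hy : ∀ n, jacobiExpr a b y n = c * y n) (h0 : y 0 = 0) (h1 : y 1 = 0) : y = 0 := by
  have hne : ∀ n, (a n : ℂ) ≠ 0 := fun n => by exact_mod_cast (hpos n).ne'
  have h : ∀ n : ℤ, y n = 0 ∧ y (n + 1) = 0 := by
    intro n
    induction n using Int.induction_on with
    | zero => exact ⟨h0, by simpa using h1⟩
    | succ k ih =>
      refine ⟨ih.2, ?_⟩
      have h := hy (k + 1)
      rw [jacobiExpr, add_sub_cancel_right, ih.1, ih.2] at h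
      simpa [hne] using h
    | pred k ih =>
      have h := hy (-k)
      rw [jacobiExpr, ih.1, ih.2] at h
      rw [sub_add_cancel]
      exact ⟨by simpa [hne] using h, ih.1⟩
  funext n
  exact (h n).1

/-- Conservation of the Wronskian: two Bloch solutions of the same eigenvalue equation have equal
or inverse multipliers. -/
theorem IsBloch.multiplier_eq_or_mul_eq_one (ha : Function.Periodic a (p : ℤ))
    (hpos : ∀ n, 0 < a n) {c : ℂ} (hx : IsBloch p z x) (hy : IsBloch p w y)
    (hx' : ∀ n, jacobiExpr a b x n = c * x n) (hy' : ∀ n, jacobiExpr a b y n = c * y n)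
    (hx0 : x ≠ 0) (hy0 : y ≠ 0) : z = w ∨ z * w = 1 := by
  have hne : ∀ n, (a n : ℂ) ≠ 0 := fun n => by exact_mod_cast (hpos n).ne'
  set W : ℤ → ℂ := fun n => (a n : ℂ) * (x n * y (n + 1) - x (n + 1) * y n) with hW
  have step : Function.Periodic W 1 := by
    intro n
    have h1 := hx' (n + 1)
    have h2 := hy' (n + 1)
    simp only [jacobiExpr, add_sub_cancel_right] at h1 h2
    simp only [hW]
    linear_combination x (n + 1) * h2 - y (n + 1) * h1
  have hper : W p = W 0 := by simpa using step.int_mul_eq p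
  -- The Bloch conditions multiply the constant Wronskian by `z * w` over a period, so either `z * w
  -- = 1` or the Wronskian is zero and the solutions are proportional.
  have hmul : W p = z * w * W 0 := by
    have e1 := hx 0
    have e2 := hy 0
    have e3 := hx 1
    have e4 := hy 1
    have e5 := ha 0
    rw [add_comm] at e3 e4
    simp only [zero_add] at e1 e2 e5
    simp only [hW, zero_add, e1, e2, e3, e4, e5]
    ring
  by_cases hW0 : W 0 = 0
  · left
    have hD : x 0 * y 1 = x 1 * y 0 := by
      have := (mul_eq_zero.1 hW0).resolve_left (hne 0)
      rw [zero_add] at this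
      exact sub_eq_zero.1 this
    obtain ⟨i, hi⟩ : ∃ i, x i ≠ 0 := Function.ne_iff.1 hx0
    obtain ⟨s, t, hst, h⟩ : ∃ s t : ℂ, (s ≠ 0) ∧ (fun n => s * y n - t * x n) = 0 := by
      have key : ∀ s t : ℂ, s * y 0 - t * x 0 = 0 → s * y 1 - t * x 1 = 0 →
          (fun n => s * y n - t * x n) = 0 := by
        intro s t h0 h1
        refine eq_zero_of_jacobiExpr_eq (b := b) hpos (c := c) (fun n => ?_) h0 h1
        have h2 := hx' n
        have h3 := hy' n
        simp only [jacobiExpr] at h2 h3 ⊢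
        linear_combination s * h3 - t * h2
      -- The coefficient of `y` is whichever of `x 0`, `x 1` is nonzero; vanishing at both sites
      -- then kills the combination.
      by_cases h0 : x 0 = 0
      · have h1 : x 1 ≠ 0 := fun h1 => hx0 (eq_zero_of_jacobiExpr_eq hpos hx' h0 h1)
        exact ⟨x 1, y 1, h1, key _ _ (by linear_combination -hD) (by ring)⟩
      · exact ⟨x 0, y 0, h0, key _ _ (by ring) (by linear_combination hD)⟩
    obtain ⟨n, hn⟩ : ∃ n, y n ≠ 0 := Function.ne_iff.1 hy0
    have h1 := congrFun h n
    have h2 := congrFun h (n + p)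
    simp only [Pi.zero_apply, hx n, hy n] at h1 h2
    have h3 : (w - z) * (s * y n) = 0 := by linear_combination h2 - z * h1
    have h4 := (mul_eq_zero.1 h3).resolve_right (mul_ne_zero hst hn)
    exact (sub_eq_zero.1 h4).symm
  · right
    rw [hper] at hmul
    have h3 : (z * w - 1) * W 0 = 0 := by linear_combination -hmul
    exact sub_eq_zero.1 ((mul_eq_zero.1 h3).resolve_right hW0)

end Bloch

/-! ### Comparison of Floquet eigenvalues: shifts, band lengths, interlacing -/

section FloquetEigenvalues

variable {p m : ℕ} {a b : ℤ → ℝ} {z w : ℂ}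

/-- Shifting a Bloch sequence, as an isometry on the space of initial values. -/
noncomputable def blochShift (p : ℕ) [NeZero p] {z : ℂ} (hz : ‖z‖ = 1) (s : ℤ) :
    EuclideanSpace ℂ (Fin p) →ₗᵢ[ℂ] EuclideanSpace ℂ (Fin p) where
  toFun v := WithLp.toLp 2 fun i => blochExt z v ((i : ℕ) + s)
  map_add' v w := by
    ext i
    simp only [blochExt_add, PiLp.add_apply]
  map_smul' c v := by
    ext i
    simp only [blochExt_smul, PiLp.smul_apply, smul_eq_mul, RingHom.id_apply]
  norm_map' v := by
    have hB := blochExt_isBloch (ne_zero_of_norm_one hz) v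
    rw [← sq_eq_sq₀ (norm_nonneg _) (norm_nonneg _), norm_sq_eq_sum_blochExt z v]
    have hper : Function.Periodic (fun n => ‖blochExt z v n‖ ^ 2) (p : ℤ) := fun n => by
      have := hB.norm_periodic hz n
      simp only at this ⊢
      rw [this]
    have h := hper.sum_range_add s
    rw [← h, Finset.sum_range, EuclideanSpace.norm_sq_eq]
    rfl

theorem blochExt_blochShift [NeZero p] (hz : ‖z‖ = 1) (s : ℤ) (v : EuclideanSpace ℂ (Fin p)) :
    blochExt z (blochShift p hz s v) = fun n => blochExt z v (n + s) :=
  ((blochExt_isBloch (ne_zero_of_norm_one hz) v).shift s).blochExt_toLp (ne_zero_of_norm_one hz)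

/-- The energy density is periodic, so its sum over a period does not see the shift. Estimates
proved at one distinguished site thereby hold at every site. -/
theorem ascEigenvalue_floquet_shift [NeZero p] (ha : Function.Periodic a (p : ℤ))
    (hb : Function.Periodic b (p : ℤ)) (hz : ‖z‖ = 1) (s : ℤ) {i : ℕ} (hi : i < p) :
    ascEigenvalue (floquet (fun n => a (n + s)) (fun n => b (n + s)) p z) i =
      ascEigenvalue (floquet a b p z) i := by
  have ha' : Function.Periodic (fun n => a (n + s)) (p : ℤ) := fun n => by
    simp only [add_right_comm, ha (n + s)]
  have key : ∀ v, (inner ℂ (floquet (fun n => a (n + s)) (fun n => b (n + s)) p z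
      (blochShift p hz s v)) (blochShift p hz s v)).re = (inner ℂ (floquet a b p z v) v).re := by
    intro v
    rw [re_inner_floquet ha hz, re_inner_floquet ha' hz, blochExt_blochShift,
      ← ((blochExt_isBloch (ne_zero_of_norm_one hz) v).jacobiEnergy_periodic ha hb hz).sum_range_add
        s]
    refine Finset.sum_congr rfl fun n _ => ?_
    simp only [jacobiEnergy]
    rw [add_right_comm]
  have hi' : i < finrank ℂ (EuclideanSpace ℂ (Fin p)) := by simpa using hi
  have h1 := ascEigenvalue_le_of_inner_le (ε := 0) (floquet_isSymmetric (b := fun n => b (n + s))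
    ha' hz) (floquet_isSymmetric (b := b) ha hz) (blochShift p hz s)
    (fun v => by rw [key]; simp) hi'
  have h2 := ascEigenvalue_le_of_le_inner (floquet_isSymmetric (b := fun n => b (n + s)) ha' hz)
    (floquet_isSymmetric (b := b) ha hz) (blochShift p hz s) (fun v => (key v).ge) hi'
  simp only [add_zero, tsub_self] at h1 h2
  exact le_antisymm h1 h2

theorem blochExt_of_lt [NeZero p] (z : ℂ) (v : EuclideanSpace ℂ (Fin p)) {n : ℕ} (hn : n < p) :
    blochExt z v (n : ℤ) = v ⟨n, hn⟩ := blochExt_natCast z v ⟨n, hn⟩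

theorem blochExt_period (hz : z ≠ 0) (v : EuclideanSpace ℂ (Fin (m + 1))) :
    blochExt z v ((m : ℤ) + 1) = z * v 0 := by
  have h := blochExt_isBloch hz v 0
  have h0 := blochExt_natCast z v 0
  simp only [Fin.val_zero, Nat.cast_zero] at h0
  rw [h0] at h
  rw [← h]
  push_cast
  rw [zero_add]

/-- The multiplier enters only through the bond that closes the period, with coefficient `a m`.
Continuity in `z`, the band-length bound and the interlacing all rest on this. -/
theorem re_inner_floquet_eq (ha : Function.Periodic a ((m + 1 : ℕ) : ℤ)) (hz : ‖z‖ = 1)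
    (v : EuclideanSpace ℂ (Fin (m + 1))) :
    (inner ℂ (floquet a b (m + 1) z v) v).re =
      (∑ n : Fin (m + 1), b (n : ℕ) * ‖v n‖ ^ 2) +
      (∑ n : Fin m, 2 * a (n : ℕ) * ((starRingEnd ℂ) (v n.castSucc) * v n.succ).re) +
      2 * a m * ((starRingEnd ℂ) (v (Fin.last m)) * (z * v 0)).re := by
  rw [re_inner_floquet ha hz]
  simp only [jacobiEnergy, Finset.sum_add_distrib]
  rw [add_assoc]
  congr 1
  · rw [Finset.sum_range]
    simp
  · rw [Finset.sum_range_succ, blochExt_period (ne_zero_of_norm_one hz),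
      blochExt_of_lt z v (Nat.lt_succ_self m), Finset.sum_range]
    congr 1
    refine Finset.sum_congr rfl fun n _ => ?_
    have h1 := blochExt_natCast z v n.castSucc
    have h2 := blochExt_natCast z v n.succ
    simp only [Fin.val_castSucc, Fin.val_succ, Nat.cast_add, Nat.cast_one] at h1 h2
    rw [h1, h2]

theorem ascEigenvalue_floquet_le (ha : Function.Periodic a ((m + 1 : ℕ) : ℤ)) (ham : 0 ≤ a m)
    (hz : ‖z‖ = 1) (hw : ‖w‖ = 1) {i : ℕ} (hi : i < m + 1) :
    ascEigenvalue (floquet a b (m + 1) z) i ≤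
      ascEigenvalue (floquet a b (m + 1) w) i + 2 * a m * ‖z - w‖ := by
  refine ascEigenvalue_le_add (floquet_isSymmetric ha hz) (floquet_isSymmetric ha hw)
    (fun v => ?_) (by simpa using hi)
  rw [re_inner_floquet_eq ha hz, re_inner_floquet_eq ha hw, add_assoc (_ + _)]
  refine add_le_add_right ?_ _
  rw [← sub_le_iff_le_add', ← mul_sub, ← Complex.sub_re, ← mul_sub, ← sub_mul, mul_assoc _ _ (_ ^ _)]
  refine mul_le_mul_of_nonneg_left ((Complex.re_le_norm _).trans ?_) (by linarith)
  rw [norm_mul, norm_mul, RCLike.norm_conj]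
  nlinarith [PiLp.norm_apply_le v 0, PiLp.norm_apply_le v (Fin.last m), norm_nonneg (v 0),
    norm_nonneg (v (Fin.last m)), norm_nonneg (z - w), norm_nonneg v,
    mul_le_mul (PiLp.norm_apply_le v (Fin.last m)) (PiLp.norm_apply_le v 0) (norm_nonneg _)
      (norm_nonneg _)]

/-- The total length of the bands is at most `4 a m`, as periodic and antiperiodic boundary
conditions differ by an operator of rank two. -/
theorem sum_abs_floquet_sub_le (ha : Function.Periodic a ((m + 1 : ℕ) : ℤ)) (ham : 0 ≤ a m) :
    ∑ i ∈ Finset.range (m + 1), |ascEigenvalue (floquet a b (m + 1) 1) i -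
      ascEigenvalue (floquet a b (m + 1) (-1)) i| ≤ 4 * a m := by
  have h1 : ‖(1 : ℂ)‖ = 1 := by simp
  have h2 : ‖(-1 : ℂ)‖ = 1 := by simp
  set φ : EuclideanSpace ℂ (Fin (m + 1)) :=
    EuclideanSpace.single 0 1 + EuclideanSpace.single (Fin.last m) 1 with hφ
  have hin : ∀ v, inner ℂ φ v = v 0 + v (Fin.last m) := by
    intro v
    simp [hφ, EuclideanSpace.inner_single_left]
  -- Adding `a m * ‖v 0 + v m‖ ^ 2` to the antiperiodic form replaces its closing bond by `a m * (‖v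
  -- 0‖ ^ 2 + ‖v m‖ ^ 2)`, which exceeds the periodic bond by `a m * ‖v 0 - v m‖ ^ 2`. This gives a
  -- common upper bound of both operators.
  set R : EuclideanSpace ℂ (Fin (m + 1)) →ₗ[ℂ] EuclideanSpace ℂ (Fin (m + 1)) :=
    LinearMap.toSpanSingleton ℂ _ φ ∘ₗ (innerₛₗ ℂ φ) with hR
  have hR' : ∀ v w, inner ℂ (R v) w =
      (starRingEnd ℂ) (v 0 + v (Fin.last m)) * (w 0 + w (Fin.last m)) := by
    intro v w
    simp [hR, hin, mul_comm]
  have hRs : R.IsSymmetric := by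
    intro v w
    rw [← inner_conj_symm v, hR', hR', map_mul, Complex.conj_conj, mul_comm]
  have hA := floquet_isSymmetric (b := b) ha h1
  have hB := floquet_isSymmetric (b := b) ha h2
  have hC : (floquet a b (m + 1) (-1) + (a m : ℂ) • R).IsSymmetric :=
    hB.add (hRs.smul (Complex.conj_ofReal _))
  have hCB : ∀ v, (inner ℂ ((floquet a b (m + 1) (-1) + (a m : ℂ) • R) v) v).re =
      (inner ℂ (floquet a b (m + 1) (-1) v) v).re + a m * ‖v 0 + v (Fin.last m)‖ ^ 2 := by
    intro v
    rw [LinearMap.add_apply, inner_add_left, Complex.add_re, LinearMap.smul_apply, inner_smul_left,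
      hR', Complex.conj_ofReal, Complex.re_ofReal_mul, Complex.sq_norm,
      Complex.normSq_eq_conj_mul_self.symm, Complex.ofReal_re]
  have hCA : ∀ v, (inner ℂ ((floquet a b (m + 1) (-1) + (a m : ℂ) • R) v) v).re =
      (inner ℂ (floquet a b (m + 1) 1 v) v).re + a m * ‖v 0 - v (Fin.last m)‖ ^ 2 := by
    intro v
    rw [hCB, re_inner_floquet_eq ha h1, re_inner_floquet_eq ha h2]
    simp only [Complex.sq_norm, Complex.normSq_apply, Complex.add_re, Complex.mul_re,
      Complex.add_im, Complex.mul_im, Complex.conj_re, Complex.conj_im, Complex.sub_re,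
      Complex.sub_im, Complex.neg_re, Complex.neg_im, Complex.one_re, Complex.one_im]
    ring
  refine (sum_abs_ascEigenvalue_sub_le hA hB hC
    (fun v => by rw [hCA]; nlinarith [sq_nonneg ‖v 0 - v (Fin.last m)‖])
    (fun v => by rw [hCB]; nlinarith [sq_nonneg ‖v 0 + v (Fin.last m)‖]) (by simp)).trans ?_
  rw [LinearMap.trace_eq_sum_inner _ (EuclideanSpace.basisFun (Fin (m + 1)) ℂ),
    LinearMap.trace_eq_sum_inner _ (EuclideanSpace.basisFun (Fin (m + 1)) ℂ), Complex.re_sum,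
    Complex.re_sum, ← Finset.sum_add_distrib]
  have e : ∀ i : Fin (m + 1),
      ∀ T : EuclideanSpace ℂ (Fin (m + 1)) →ₗ[ℂ] EuclideanSpace ℂ (Fin (m + 1)),
      (inner ℂ (EuclideanSpace.basisFun (Fin (m + 1)) ℂ i)
        (T (EuclideanSpace.basisFun (Fin (m + 1)) ℂ i))).re =
      (inner ℂ (T (EuclideanSpace.basisFun (Fin (m + 1)) ℂ i))
        (EuclideanSpace.basisFun (Fin (m + 1)) ℂ i)).re := by
    intro i T
    rw [← inner_conj_symm, Complex.conj_re]
  have e2 : ∀ i : Fin (m + 1), ∀ v : EuclideanSpace ℂ (Fin (m + 1)),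
      v = EuclideanSpace.basisFun (Fin (m + 1)) ℂ i →
      (inner ℂ v ((floquet a b (m + 1) (-1) + (a m : ℂ) • R - floquet a b (m + 1) 1) v)).re +
      (inner ℂ v ((floquet a b (m + 1) (-1) + (a m : ℂ) • R - floquet a b (m + 1) (-1)) v)).re =
        2 * a m * (‖v 0‖ ^ 2 + ‖v (Fin.last m)‖ ^ 2) := by
    rintro i v rfl
    rw [e, e, LinearMap.sub_apply, inner_sub_left, LinearMap.sub_apply, inner_sub_left,
      Complex.sub_re, Complex.sub_re, hCA]
    -- Adding the two traces before evaluating them makes the cross terms cancel, so the case `m =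
    -- 0`, where both end sites coincide, needs no separate treatment.
    have := parallelogram_law_with_norm ℝ ((EuclideanSpace.basisFun (Fin (m + 1)) ℂ i) 0)
      ((EuclideanSpace.basisFun (Fin (m + 1)) ℂ i) (Fin.last m))
    have h3 := hCA (EuclideanSpace.basisFun (Fin (m + 1)) ℂ i)
    have h4 := hCB (EuclideanSpace.basisFun (Fin (m + 1)) ℂ i)
    nlinarith
  rw [Finset.sum_congr rfl fun i _ => e2 i _ rfl, ← Finset.mul_sum, Finset.sum_add_distrib]
  simp [apply_ite]
  linarith

/-- The eigenvalues of the Floquet operators interlace with those of their common restriction to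
sequences vanishing at `0`, whose trace is `b 1 + … + b m`. -/
theorem exists_interlacing (ha : Function.Periodic a ((m + 1 : ℕ) : ℤ)) (b : ℤ → ℝ) :
    ∃ μ : ℕ → ℝ, (∀ i < m, ∀ z : ℂ, ‖z‖ = 1 →
        ascEigenvalue (floquet a b (m + 1) z) i ≤ μ i ∧
        μ i ≤ ascEigenvalue (floquet a b (m + 1) z) (i + 1)) ∧
      ∑ i ∈ Finset.range m, μ i = ∑ n ∈ Finset.range m, b (n + 1) := by
  have h1 : ‖(1 : ℂ)‖ = 1 := by simp
  let e : EuclideanSpace ℂ (Fin m) →ₗᵢ[ℂ] EuclideanSpace ℂ (Fin (m + 1)) :=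
    { toFun := fun v => WithLp.toLp 2 (Fin.cons 0 v : Fin (m + 1) → ℂ)
      map_add' := fun v w => by
        ext i
        refine Fin.cases ?_ (fun j => ?_) i <;> simp
      map_smul' := fun c v => by
        ext i
        refine Fin.cases ?_ (fun j => ?_) i <;> simp
      norm_map' := fun v => by
        rw [← sq_eq_sq₀ (norm_nonneg _) (norm_nonneg _), EuclideanSpace.norm_sq_eq,
          EuclideanSpace.norm_sq_eq]
        simp [Fin.sum_univ_succ] }
  have he0 : ∀ v, e v 0 = 0 := fun v => rfl
  have hes : ∀ v j, e v (Fin.succ j) = v j := fun v j => rfl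
  set S : EuclideanSpace ℂ (Fin m) →ₗ[ℂ] EuclideanSpace ℂ (Fin m) :=
    LinearMap.adjoint e.toLinearMap ∘ₗ floquet a b (m + 1) 1 ∘ₗ e.toLinearMap with hSdef
  have hSin : ∀ v w, inner ℂ (S v) w = inner ℂ (floquet a b (m + 1) 1 (e v)) (e w) := by
    intro v w
    simp [hSdef, LinearMap.adjoint_inner_left]
  have hS : S.IsSymmetric := by
    intro v w
    rw [hSin, ← inner_conj_symm v, hSin, inner_conj_symm]
    exact floquet_isSymmetric ha h1 _ _
  -- The closing bond contains the factor `v 0`, which vanishes on the image of `e`; hence one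
  -- compression `S` serves all `z`.
  have hQ : ∀ z : ℂ, ‖z‖ = 1 → ∀ v,
      (inner ℂ (floquet a b (m + 1) z (e v)) (e v)).re = (inner ℂ (S v) v).re := by
    intro z hz v
    rw [hSin, re_inner_floquet_eq ha hz, re_inner_floquet_eq ha h1, he0]
    simp
  refine ⟨ascEigenvalue S, fun i hi z hz => ⟨?_, ?_⟩, ?_⟩
  · have := ascEigenvalue_le_of_inner_le (ε := 0) (floquet_isSymmetric (b := b) ha hz) hS e
      (fun v => by rw [hQ z hz]; simp) (by simpa using hi)
    simpa using this
  · have := ascEigenvalue_le_of_le_inner (floquet_isSymmetric (b := b) ha hz) hS e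
      (fun v => (hQ z hz v).ge) (by simpa using hi)
    simpa using this
  · rw [sum_ascEigenvalue hS (by simp),
      LinearMap.trace_eq_sum_inner _ (EuclideanSpace.basisFun (Fin m) ℂ), Complex.re_sum,
      Finset.sum_range]
    refine Finset.sum_congr rfl fun j _ => ?_
    rw [← inner_conj_symm, Complex.conj_re, hSin, re_inner_floquet_eq ha h1, he0,
      -- The image of a basis vector is supported at the single site `j.succ`, so every bond term
      -- has a vanishing factor and only the diagonal entry remains.
      Finset.sum_eq_single j.succ, Finset.sum_eq_zero]
    · simp [hes]
    · intro n _
      rcases eq_or_ne n.succ j.succ with h | h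
      · have h3 : n.castSucc ≠ j.succ := by
          rw [← h]; exact (Fin.castSucc_lt_succ).ne
        have : e (EuclideanSpace.basisFun (Fin m) ℂ j) n.castSucc = 0 := by
          revert h3
          refine Fin.cases (fun _ => he0 _) (fun k hk => ?_) n.castSucc
          rw [hes]
          have : k ≠ j := fun h => hk (by rw [h])
          simp [this]
        rw [this]; simp
      · have : e (EuclideanSpace.basisFun (Fin m) ℂ j) n.succ = 0 := by
          rw [hes]
          have : n ≠ j := fun h' => h (by rw [h'])
          simp [this]
        rw [this]; simp
    · intro n _
      refine Fin.cases (fun _ => by rw [he0]; simp) (fun k hk => ?_) n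
      rw [hes]
      have : k ≠ j := fun h => hk (by rw [h])
      simp [this]
    · simp

/-- Variational bounds for the extreme eigenvalues, in terms of Bloch sequences. -/
theorem IsBloch.ascEigenvalue_mul_le (ha : Function.Periodic a ((m + 1 : ℕ) : ℤ)) (hz : ‖z‖ = 1)
    {y : ℤ → ℂ} (hy : IsBloch (m + 1) z y) :
    ascEigenvalue (floquet a b (m + 1) z) 0 * ∑ n ∈ Finset.range (m + 1), ‖y n‖ ^ 2 ≤
      ∑ n ∈ Finset.range (m + 1), jacobiEnergy a b y n ∧
    ∑ n ∈ Finset.range (m + 1), jacobiEnergy a b y n ≤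
      ascEigenvalue (floquet a b (m + 1) z) m * ∑ n ∈ Finset.range (m + 1), ‖y n‖ ^ 2 := by
  have hz0 := ne_zero_of_norm_one hz
  set v : EuclideanSpace ℂ (Fin (m + 1)) := WithLp.toLp 2 fun i => y ((i : ℕ) : ℤ) with hv
  have e : blochExt z v = y := hy.blochExt_toLp hz0
  have h1 := ascEigenvalue_zero_mul_le (floquet_isSymmetric (b := b) ha hz) (by simp) v
  have h2 := le_ascEigenvalue_last_mul (floquet_isSymmetric (b := b) ha hz) (n := m) (by simp) v
  rw [re_inner_floquet ha hz, norm_sq_eq_sum_blochExt z, e] at h1 h2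
  exact ⟨h1, h2⟩

end FloquetEigenvalues

/-! ### Bands, and the lower bounds for the sum of the gaps -/

section Bands

variable {p m : ℕ} {a b : ℤ → ℝ}

/-- The real numbers `c` for which `J y = c y` has a bounded Bloch solution. -/
def blochSpectrum (a b : ℤ → ℝ) (p : ℕ) : Set ℝ :=
  {c | ∃ z : ℂ, ‖z‖ = 1 ∧ ∃ y : ℤ → ℂ, y ≠ 0 ∧ IsBloch p z y ∧
    ∀ n, jacobiExpr a b y n = (c : ℂ) * y n}

/-- The lower edge of the `i`-th band. -/
noncomputable def bandLower (a b : ℤ → ℝ) (p : ℕ) [NeZero p] (i : ℕ) : ℝ :=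
  min (ascEigenvalue (floquet a b p 1) i) (ascEigenvalue (floquet a b p (-1)) i)

/-- The upper edge of the `i`-th band. -/
noncomputable def bandUpper (a b : ℤ → ℝ) (p : ℕ) [NeZero p] (i : ℕ) : ℝ :=
  max (ascEigenvalue (floquet a b p 1) i) (ascEigenvalue (floquet a b p (-1)) i)

theorem exists_isBloch_ascEigenvalue_floquet [NeZero p] (ha : Function.Periodic a (p : ℤ))
    (hb : Function.Periodic b (p : ℤ)) {z : ℂ} (hz : ‖z‖ = 1) {i : ℕ} (hi : i < p) :
    ∃ y : ℤ → ℂ, y ≠ 0 ∧ IsBloch p z y ∧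
      ∀ n, jacobiExpr a b y n = (ascEigenvalue (floquet a b p z) i : ℂ) * y n := by
  have hz0 := ne_zero_of_norm_one hz
  obtain ⟨v, hv, h⟩ := exists_ascEigenvalue_eigenvector
    (floquet_isSymmetric (b := b) ha hz) (i := i) (by simpa using hi)
  refine ⟨blochExt z v, fun h0 => hv ?_, blochExt_isBloch hz0 v, fun n => ?_⟩
  · ext i
    rw [← blochExt_natCast z, h0]
    simp
  · rw [← blochExt_floquet ha hb hz0, h, blochExt_smul]

theorem exists_ascEigenvalue_floquet_eq [NeZero p] (ha : Function.Periodic a (p : ℤ))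
    {z : ℂ} (hz : ‖z‖ = 1) {y : ℤ → ℂ} (hy0 : y ≠ 0)
    (hy : IsBloch p z y) {c : ℝ} (h : ∀ n, jacobiExpr a b y n = (c : ℂ) * y n) :
    ∃ i < p, ascEigenvalue (floquet a b p z) i = c := by
  have hz0 := ne_zero_of_norm_one hz
  set v : EuclideanSpace ℂ (Fin p) := WithLp.toLp 2 fun i => y ((i : ℕ) : ℤ) with hv
  have e : blochExt z v = y := hy.blochExt_toLp hz0
  have hv0 : v ≠ 0 := by
    intro h0
    apply hy0
    rw [← e, h0]
    funext n
    simp [blochExt]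
  have hv' : floquet a b p z v = (c : ℂ) • v := by
    ext i
    rw [PiLp.smul_apply, smul_eq_mul]
    change jacobiExpr a b (blochExt z v) _ = _ * y _
    rw [e, h]
  simpa using exists_ascEigenvalue_eq (floquet_isSymmetric ha hz) hv0 hv'

/-- A common eigenvalue forces the multipliers to be equal or inverse, hence to have the same real
part, and cosine is injective on `[0, π]`. -/
theorem floquet_eigenvalue_injOn (ha : Function.Periodic a (p : ℤ)) [NeZero p]
    (hb : Function.Periodic b (p : ℤ)) (hpos : ∀ n, 0 < a n) {i : ℕ} (hi : i < p) :
    Set.InjOn (fun θ : ℝ => ascEigenvalue (floquet a b p (Complex.exp (θ * Complex.I))) i)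
      (Set.Icc 0 Real.pi) := by
  intro θ hθ η hη h
  simp only at h
  have h1 := Complex.norm_exp_ofReal_mul_I θ
  have h2 := Complex.norm_exp_ofReal_mul_I η
  obtain ⟨x, hx0, hx, hx'⟩ := exists_isBloch_ascEigenvalue_floquet ha hb h1 hi
  obtain ⟨y, hy0, hy, hy'⟩ := exists_isBloch_ascEigenvalue_floquet ha hb h2 hi
  rw [← h] at hy'
  apply Real.injOn_cos hθ hη
  have hc : (Complex.exp (θ * Complex.I)).re = (Complex.exp (η * Complex.I)).re := by
    rcases hx.multiplier_eq_or_mul_eq_one ha hpos hy hx' hy' hx0 hy0 with h3 | h3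
    · rw [h3]
    · have h4 := conj_mul_self_of_norm_one h2
      have h5 : Complex.exp (θ * Complex.I) = (starRingEnd ℂ) (Complex.exp (η * Complex.I)) :=
        mul_right_cancel₀ (Complex.exp_ne_zero _) (h3.trans h4.symm)
      rw [h5, Complex.conj_re]
  simpa [Complex.exp_ofReal_mul_I_re] using hc

theorem continuous_floquet_eigenvalue (ha : Function.Periodic a ((m + 1 : ℕ) : ℤ))
    (hpos : ∀ n, 0 < a n) {i : ℕ} (hi : i < m + 1) :
    Continuous fun θ : ℝ =>
      ascEigenvalue (floquet a b (m + 1) (Complex.exp (θ * Complex.I))) i := by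
  rw [continuous_iff_continuousAt]
  intro θ
  have hc : Continuous fun η : ℝ =>
      2 * a m * ‖Complex.exp (η * Complex.I) - Complex.exp (θ * Complex.I)‖ := by fun_prop
  rw [ContinuousAt, tendsto_iff_norm_sub_tendsto_zero]
  have h0 := hc.tendsto θ
  simp only [sub_self, norm_zero, mul_zero] at h0
  refine squeeze_zero (fun _ => norm_nonneg _) (fun η => ?_) h0
  have h1 := Complex.norm_exp_ofReal_mul_I θ
  have h2 := Complex.norm_exp_ofReal_mul_I η
  have h3 := ascEigenvalue_floquet_le (b := b) ha (hpos m).le h1 h2 hi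
  have h4 := ascEigenvalue_floquet_le (b := b) ha (hpos m).le h2 h1 hi
  rw [norm_sub_rev] at h3
  rw [Real.norm_eq_abs, abs_le]
  constructor <;> linarith

theorem Set.InjOn.image_Icc_eq_uIcc {f : ℝ → ℝ} {s t : ℝ} (hst : s ≤ t)
    (hf : ContinuousOn f (Set.Icc s t)) (hi : Set.InjOn f (Set.Icc s t)) :
    f '' Set.Icc s t = Set.uIcc (f s) (f t) := by
  refine Set.Subset.antisymm ?_ ?_
  · rintro _ ⟨x, hx, rfl⟩
    have hs : s ∈ Set.Icc s t := ⟨le_rfl, hst⟩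
    have ht : t ∈ Set.Icc s t := ⟨hst, le_rfl⟩
    rcases hf.strictMonoOn_of_injOn_Icc' hst hi with h | h
    · exact Set.Icc_subset_uIcc ⟨h.monotoneOn hs hx hx.1, h.monotoneOn hx ht hx.2⟩
    · exact Set.Icc_subset_uIcc' ⟨h.antitoneOn hx ht hx.2, h.antitoneOn hs hx hx.1⟩
  · have := intermediate_value_uIcc (f := f) (a := s) (b := t) (by rwa [Set.uIcc_of_le hst])
    rwa [Set.uIcc_of_le hst] at this

/-- A continuous injective function on an interval is monotone, so the extremes are attained at `θ =
0` and `θ = π`, that is at `z = 1` and `z = -1`. -/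
theorem image_floquet_eigenvalue (ha : Function.Periodic a ((m + 1 : ℕ) : ℤ))
    (hb : Function.Periodic b ((m + 1 : ℕ) : ℤ)) (hpos : ∀ n, 0 < a n) {i : ℕ} (hi : i < m + 1) :
    (fun θ : ℝ => ascEigenvalue (floquet a b (m + 1) (Complex.exp (θ * Complex.I))) i) ''
      Set.Icc 0 Real.pi = Set.Icc (bandLower a b (m + 1) i) (bandUpper a b (m + 1) i) := by
  rw [(floquet_eigenvalue_injOn ha hb hpos hi).image_Icc_eq_uIcc Real.pi_pos.le
    (continuous_floquet_eigenvalue ha hpos hi).continuousOn]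
  simp [Set.uIcc, bandLower, bandUpper, Complex.exp_pi_mul_I]

theorem blochSpectrum_eq (ha : Function.Periodic a ((m + 1 : ℕ) : ℤ))
    (hb : Function.Periodic b ((m + 1 : ℕ) : ℤ)) (hpos : ∀ n, 0 < a n) :
    blochSpectrum a b (m + 1) = ⋃ i ∈ Finset.range (m + 1),
      Set.Icc (bandLower a b (m + 1) i) (bandUpper a b (m + 1) i) := by
  ext c
  simp only [Set.mem_iUnion, Finset.mem_range, exists_prop]
  constructor
  · rintro ⟨z, hz, y, hy0, hy, h⟩
    obtain ⟨θ, hθ, y, hy0, hy, h⟩ : ∃ θ ∈ Set.Icc 0 Real.pi, ∃ y : ℤ → ℂ, y ≠ 0 ∧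
        IsBloch (m + 1) (Complex.exp ((θ : ℝ) * Complex.I)) y ∧
        ∀ n, jacobiExpr a b y n = (c : ℂ) * y n := by
      have hexp : Complex.exp ((z.arg : ℝ) * Complex.I) = z := by
        have := Complex.norm_mul_exp_arg_mul_I z
        rwa [hz, Complex.ofReal_one, one_mul] at this
      by_cases hθ : 0 ≤ z.arg
      · exact ⟨z.arg, ⟨hθ, Complex.arg_le_pi z⟩, y, hy0, by rwa [hexp], h⟩
      -- The coefficients are real, so conjugating a solution inverts its multiplier and brings the
      -- angle into `[0, π]`.
      · refine ⟨-z.arg, ⟨by linarith, by linarith [Complex.neg_pi_lt_arg z]⟩,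
          fun n => (starRingEnd ℂ) (y n), fun h0 => hy0 ?_, fun n => ?_, fun n => ?_⟩
        · funext n
          simpa using congrFun h0 n
        · have e : Complex.exp (((-z.arg : ℝ) : ℂ) * Complex.I) = (starRingEnd ℂ) z := by
            conv_rhs => rw [← hexp]
            rw [← Complex.exp_conj]
            simp
          simp only
          rw [e, hy n, map_mul]
        · have := congrArg (starRingEnd ℂ) (h n)
          simpa [jacobiExpr] using this
    obtain ⟨i, hi, h1⟩ := exists_ascEigenvalue_floquet_eq ha
      (Complex.norm_exp_ofReal_mul_I θ) hy0 hy h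
    refine ⟨i, hi, ?_⟩
    rw [← image_floquet_eigenvalue ha hb hpos hi]
    exact ⟨θ, hθ, h1⟩
  · rintro ⟨i, hi, hc⟩
    rw [← image_floquet_eigenvalue ha hb hpos hi] at hc
    obtain ⟨θ, -, rfl⟩ := hc
    exact ⟨_, Complex.norm_exp_ofReal_mul_I θ,
      exists_isBloch_ascEigenvalue_floquet ha hb (Complex.norm_exp_ofReal_mul_I θ) hi⟩

theorem bandLower_lt_bandUpper (ha : Function.Periodic a ((m + 1 : ℕ) : ℤ))
    (hb : Function.Periodic b ((m + 1 : ℕ) : ℤ)) (hpos : ∀ n, 0 < a n) {i : ℕ} (hi : i < m + 1) :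
    bandLower a b (m + 1) i < bandUpper a b (m + 1) i := by
  rw [bandLower, bandUpper, min_lt_max]
  intro h
  have := floquet_eigenvalue_injOn (b := b) ha hb hpos hi (x₁ := 0) (x₂ := Real.pi)
    ⟨le_rfl, Real.pi_pos.le⟩ ⟨Real.pi_pos.le, le_rfl⟩ (by simpa [Complex.exp_pi_mul_I] using h)
  exact Real.pi_pos.ne this

/-- The interlacing value `μ i` does not depend on `z`, so it separates consecutive bands. -/
theorem bandUpper_le_bandLower_succ (ha : Function.Periodic a ((m + 1 : ℕ) : ℤ)) (b : ℤ → ℝ)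
    {i : ℕ} (hi : i < m) : bandUpper a b (m + 1) i ≤ bandLower a b (m + 1) (i + 1) := by
  obtain ⟨μ, hμ, -⟩ := exists_interlacing ha b
  have h1 := hμ i hi 1 (by simp)
  have h2 := hμ i hi (-1) (by simp)
  exact (max_le h1.1 h2.1).trans (le_min h1.2 h2.2)

theorem bandLower_shift [NeZero p] (ha : Function.Periodic a (p : ℤ))
    (hb : Function.Periodic b (p : ℤ)) (s : ℤ) {i : ℕ} (hi : i < p) :
    bandLower (fun n => a (n + s)) (fun n => b (n + s)) p i = bandLower a b p i := by
  rw [bandLower, bandLower, ascEigenvalue_floquet_shift ha hb (by simp) s hi,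
    ascEigenvalue_floquet_shift ha hb (by simp) s hi]

theorem bandUpper_shift [NeZero p] (ha : Function.Periodic a (p : ℤ))
    (hb : Function.Periodic b (p : ℤ)) (s : ℤ) {i : ℕ} (hi : i < p) :
    bandUpper (fun n => a (n + s)) (fun n => b (n + s)) p i = bandUpper a b p i := by
  rw [bandUpper, bandUpper, ascEigenvalue_floquet_shift ha hb (by simp) s hi,
    ascEigenvalue_floquet_shift ha hb (by simp) s hi]

theorem Function.Periodic.shift {f : ℤ → ℝ} {t : ℤ} (hf : Function.Periodic f t) (s : ℤ) :
    Function.Periodic (fun n => f (n + s)) t := fun n => by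
  simp only [add_right_comm n t s, hf (n + s)]

theorem sum_gaps_eq (l u : ℕ → ℝ) (m : ℕ) :
    ∑ i ∈ Finset.range m, (l (i + 1) - u i) =
      u m - l 0 - ∑ i ∈ Finset.range (m + 1), (u i - l i) := by
  induction m with
  | zero => simp
  | succ m ih => rw [Finset.sum_range_succ, ih, Finset.sum_range_succ _ (m + 1)]; ring

/-- The spread of the spectrum, tested with `w n` and with `(-1) ^ n * w n`. -/
theorem four_mul_sum_le_spread (ha : Function.Periodic a ((m + 1 : ℕ) : ℤ)) (b : ℤ → ℝ)
    {w : ℤ → ℝ} (hw : Function.Periodic w ((m + 1 : ℕ) : ℤ)) :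
    4 * ∑ n ∈ Finset.range (m + 1), a n * (w n * w (n + 1)) ≤
      (bandUpper a b (m + 1) m - bandLower a b (m + 1) 0) *
        ∑ n ∈ Finset.range (m + 1), w n ^ 2 := by
  have hW : 0 ≤ ∑ n ∈ Finset.range (m + 1), w n ^ 2 := Finset.sum_nonneg fun _ _ => sq_nonneg _
  have h1 := (IsBloch.ascEigenvalue_mul_le (b := b) ha (z := 1) (by simp) (y := fun n => (w n : ℂ))
    (fun n => by simp [show w (n + (m + 1)) = w n by simpa using hw n])).2
  have hneg : ∀ n : ℤ, ((-1 : ℂ) ^ n) * (-1 : ℂ) ^ n = 1 := fun n => by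
    rw [← mul_zpow]; simp
  -- The alternating sign reverses the coupling energy and keeps the diagonal energy, so `b` cancels
  -- in the difference. The multiplier is `1` or `-1`, either of which `bandLower` covers.
  have h2 := (IsBloch.ascEigenvalue_mul_le (b := b) ha (z := (-1) ^ (m + 1)) (by simp)
    (y := fun n => (-1) ^ n * (w n : ℂ)) (fun n => by
      simp only
      rw [hw, zpow_add₀ (by norm_num), zpow_natCast]; ring)).1
  have e1 : ∀ n : ℤ, jacobiEnergy a b (fun n => (w n : ℂ)) n =
      b n * w n ^ 2 + 2 * (a n * (w n * w (n + 1))) := by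
    intro n
    simp [jacobiEnergy, mul_assoc]
  have e2 : ∀ n : ℤ, jacobiEnergy a b (fun n => (-1) ^ n * (w n : ℂ)) n =
      b n * w n ^ 2 - 2 * (a n * (w n * w (n + 1))) := by
    intro n
    have h : (starRingEnd ℂ) ((-1) ^ n * (w n : ℂ)) * ((-1) ^ (n + 1) * (w (n + 1) : ℂ)) =
        ((-(w n * w (n + 1)) : ℝ) : ℂ) := by
      rw [zpow_add_one₀ (by norm_num)]
      simp only [map_mul, map_zpow₀, map_neg, map_one, Complex.conj_ofReal]
      push_cast
      linear_combination -((w n : ℂ) * w (n + 1)) * hneg n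
    simp only [jacobiEnergy, h, Complex.ofReal_re]
    simp
    ring
  simp only [e1, e2, Finset.sum_add_distrib, Finset.sum_sub_distrib, ← Finset.mul_sum] at h1 h2
  simp only [Complex.norm_real, Real.norm_eq_abs, sq_abs, norm_mul, norm_zpow, norm_neg, norm_one,
    one_zpow, one_mul] at h1 h2
  have h3 : ascEigenvalue (floquet a b (m + 1) 1) m ≤ bandUpper a b (m + 1) m := le_max_left _ _
  have h4 : bandLower a b (m + 1) 0 ≤ ascEigenvalue (floquet a b (m + 1) ((-1) ^ (m + 1))) 0 := by
    rcases neg_one_pow_eq_or ℂ (m + 1) with h | h <;> rw [h]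
    · exact min_le_left _ _
    · exact min_le_right _ _
  have h5 := mul_le_mul_of_nonneg_right h3 hW
  have h6 := mul_le_mul_of_nonneg_right h4 hW
  linarith

/-- The constant test sequence bounds the spread below by four times the arithmetic mean of `a`;
then AM-GM applies. -/
theorem geom_mean_le_spread (ha : Function.Periodic a ((m + 1 : ℕ) : ℤ)) (b : ℤ → ℝ)
    (hpos : ∀ n, 0 < a n) :
    4 * (∏ n ∈ Finset.Icc 1 (m + 1), a (n : ℤ)) ^ (1 / ((m + 1 : ℕ) : ℝ)) ≤
      bandUpper a b (m + 1) m - bandLower a b (m + 1) 0 := by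
  have h1 := four_mul_sum_le_spread ha b (w := fun _ => 1) (fun _ => rfl)
  have h2 := Real.geom_mean_le_arith_mean (Finset.Icc 1 (m + 1)) (fun _ => 1)
    (fun n => a (n : ℤ)) (fun _ _ => zero_le_one) (by simp; positivity) (fun n _ => (hpos n).le)
  simp only [Real.rpow_one, Finset.sum_const, Nat.card_Icc, nsmul_eq_mul, one_mul] at h2
  have h3 : ∑ n ∈ Finset.Icc 1 (m + 1), a (n : ℤ) = ∑ n ∈ Finset.range (m + 1), a n := by
    rw [← ha.sum_range_add 1, show Finset.Icc 1 (m + 1) = Finset.Ico 1 (m + 1 + 1) from rfl,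
      Finset.sum_Ico_eq_sum_range]
    refine Finset.sum_congr rfl fun n _ => ?_
    congr 1
    push_cast
    ring
  rw [h3] at h2
  have hp : (0 : ℝ) < ((m + 1 : ℕ) : ℝ) := by positivity
  simp only [mul_one, one_pow, Finset.sum_const, Finset.card_range, nsmul_eq_mul] at h1
  rw [one_div]
  simp only [add_tsub_cancel_right, mul_one] at h2
  refine (mul_le_mul_of_nonneg_left h2 (by norm_num)).trans ?_
  rw [← mul_div_assoc, div_le_iff₀ hp]
  exact h1

theorem two_mul_zero_le_spread (ha : Function.Periodic a ((m + 1 : ℕ) : ℤ)) (b : ℤ → ℝ)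
    (hpos : ∀ n, 0 < a n) :
    2 * a 0 ≤ bandUpper a b (m + 1) m - bandLower a b (m + 1) 0 := by
  set χ : ℤ → ℝ := fun n => if n % ((m + 1 : ℕ) : ℤ) = 0 then 1 else 0 with hχ
  have hχp : Function.Periodic χ ((m + 1 : ℕ) : ℤ) := fun n => by
    simp only [hχ, Int.add_emod_right]
  have hχ1 : ∀ n, χ n = 0 ∨ χ n = 1 := fun n => by
    simp only [hχ]; split_ifs <;> simp
  have hχs : ∑ n ∈ Finset.range (m + 1), χ n = 1 := by
    rw [Finset.sum_eq_single_of_mem 0 (by simp)]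
    · simp [hχ]
    · intro n hn hn0
      have hn := Finset.mem_range.1 hn
      simp only [hχ]
      rw [if_neg]
      rw [Int.emod_eq_of_lt (by omega) (by omega)]
      omega
  -- The test sequence is the indicator of the residues of `0` and `1`, the two ends of the bond `a
  -- 0`. The maximum keeps it an indicator when the residues coincide (`m = 0`), so its squared norm
  -- lies between `1` and `2`.
  set w : ℤ → ℝ := fun n => max (χ n) (χ (n + -1)) with hw
  have hwp : Function.Periodic w ((m + 1 : ℕ) : ℤ) := fun n => by
    simp only [hw]
    rw [hχp, add_right_comm, hχp]
  have hw0 : ∀ n, 0 ≤ w n := fun n => by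
    rcases hχ1 n with h | h <;> simp [hw, h]
  have hwle : ∀ n, w n ^ 2 ≤ χ n + χ (n + -1) := fun n => by
    rcases hχ1 n with h | h <;> rcases hχ1 (n + -1) with h' | h' <;> simp [hw, h, h']
  have hχ0 : χ 0 = 1 := by simp [hχ]
  have hw00 : w 0 = 1 := by
    rcases hχ1 (0 + -1) with h | h <;> simp only [hw, h, hχ0] <;> simp
  have hw1 : w 1 = 1 := by
    have h0 : χ (1 + -1) = 1 := by simpa using hχ0
    rcases hχ1 1 with h | h <;> simp only [hw, h, h0] <;> simp
  have h1 := four_mul_sum_le_spread ha b hwp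
  have h2 : a 0 ≤ ∑ n ∈ Finset.range (m + 1), a n * (w n * w (n + 1)) := by
    have := Finset.single_le_sum (f := fun n : ℕ => a n * (w n * w (n + 1)))
      (fun n _ => mul_nonneg (hpos n).le (mul_nonneg (hw0 _) (hw0 _)))
      (Finset.mem_range.2 (Nat.succ_pos m))
    simpa [hw00, hw1] using this
  have h3 : ∑ n ∈ Finset.range (m + 1), w n ^ 2 ≤ 2 := by
    have h : ∑ n ∈ Finset.range (m + 1), w n ^ 2 ≤
        ∑ n ∈ Finset.range (m + 1), (χ n + χ (n + -1)) := Finset.sum_le_sum fun n _ => hwle n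
    refine h.trans ?_
    rw [Finset.sum_add_distrib, hχp.sum_range_add, hχs]
    norm_num
  have h4 : (1 : ℝ) ≤ ∑ n ∈ Finset.range (m + 1), w n ^ 2 := by
    have := Finset.single_le_sum (f := fun n : ℕ => w n ^ 2) (fun n _ => sq_nonneg _)
      (Finset.mem_range.2 (Nat.succ_pos m))
    simpa [hw00] using this
  have h5 := hpos 0
  nlinarith

theorem two_mul_le_spread (ha : Function.Periodic a ((m + 1 : ℕ) : ℤ))
    (hb : Function.Periodic b ((m + 1 : ℕ) : ℤ)) (hpos : ∀ n, 0 < a n) (s : ℤ) :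
    2 * a s ≤ bandUpper a b (m + 1) m - bandLower a b (m + 1) 0 := by
  have := two_mul_zero_le_spread (ha.shift s) (fun n => b (n + s)) (fun n => hpos (n + s))
  rwa [bandUpper_shift ha hb s (by simp), bandLower_shift ha hb s (by simp), zero_add] at this

theorem spread_sub_le_sum_gaps (ha : Function.Periodic a ((m + 1 : ℕ) : ℤ))
    (hb : Function.Periodic b ((m + 1 : ℕ) : ℤ)) (hpos : ∀ n, 0 < a n) (s : ℤ) :
    bandUpper a b (m + 1) m - bandLower a b (m + 1) 0 - 4 * a s ≤
      ∑ i ∈ Finset.range m, (bandLower a b (m + 1) (i + 1) - bandUpper a b (m + 1) i) := by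
  -- The shift by `s - m` makes `a s` the coefficient of the closing bond.
  have h := sum_abs_floquet_sub_le (b := fun n => b (n + (s - m))) (ha.shift (s - m))
    (hpos _).le
  rw [sum_gaps_eq]
  have e : ∑ i ∈ Finset.range (m + 1), (bandUpper a b (m + 1) i - bandLower a b (m + 1) i) ≤
      4 * a s := by
    simp only [add_sub_cancel] at h
    refine le_trans (Finset.sum_le_sum fun i hi => ?_) h
    rw [← bandUpper_shift ha hb (s - m) (Finset.mem_range.1 hi),
      ← bandLower_shift ha hb (s - m) (Finset.mem_range.1 hi), bandUpper, bandLower,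
      max_sub_min_eq_abs']
  linarith

/-- The eigenvalues `μ i` and `ν i` of the restrictions at `s` and `t` lie in the same closed gap,
and their sums are `∑ b - b s` and `∑ b - b t`. -/
theorem sub_le_sum_gaps (ha : Function.Periodic a ((m + 1 : ℕ) : ℤ))
    (hb : Function.Periodic b ((m + 1 : ℕ) : ℤ)) (s t : ℤ) :
    b s - b t ≤
      ∑ i ∈ Finset.range m, (bandLower a b (m + 1) (i + 1) - bandUpper a b (m + 1) i) := by
  have key : ∀ s : ℤ, ∃ μ : ℕ → ℝ,
      (∀ i < m, bandUpper a b (m + 1) i ≤ μ i ∧ μ i ≤ bandLower a b (m + 1) (i + 1)) ∧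
      ∑ i ∈ Finset.range m, μ i = ∑ n ∈ Finset.range (m + 1), b n - b s := by
    intro s
    obtain ⟨μ, hμ, hs⟩ := exists_interlacing (ha.shift s) (fun n => b (n + s))
    refine ⟨μ, fun i hi => ?_, ?_⟩
    · have h1 := hμ i hi 1 (by simp)
      have h2 := hμ i hi (-1) (by simp)
      rw [← bandUpper_shift ha hb s (by omega), ← bandLower_shift ha hb s (by omega)]
      exact ⟨max_le h1.1 h2.1, le_min h1.2 h2.2⟩
    · rw [hs, ← hb.sum_range_add s, Finset.sum_range_succ']
      simp
  obtain ⟨μ, hμ, h1⟩ := key s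
  obtain ⟨ν, hν, h2⟩ := key t
  calc b s - b t = ∑ i ∈ Finset.range m, (ν i - μ i) := by
        rw [Finset.sum_sub_distrib, h1, h2]; ring
    _ ≤ _ := Finset.sum_le_sum fun i hi => by
        have h3 := hμ i (Finset.mem_range.1 hi)
        have h4 := hν i (Finset.mem_range.1 hi)
        linarith

theorem max_le_sum_gaps (ha : Function.Periodic a ((m + 1 : ℕ) : ℤ))
    (hb : Function.Periodic b ((m + 1 : ℕ) : ℤ)) (hpos : ∀ n, 0 < a n) :
    max
      (max (4 * (∏ n ∈ Finset.Icc 1 (m + 1), a (n : ℤ)) ^ (1 / ((m + 1 : ℕ) : ℝ)))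
        (2 * ⨆ n : ℤ, a n) - 4 * ⨅ n : ℤ, a n)
      ((⨆ n : ℤ, b n) - ⨅ n : ℤ, b n) ≤
      ∑ i ∈ Finset.range m, (bandLower a b (m + 1) (i + 1) - bandUpper a b (m + 1) i) := by
  set G := ∑ i ∈ Finset.range m, (bandLower a b (m + 1) (i + 1) - bandUpper a b (m + 1) i)
  have h1 := geom_mean_le_spread ha b hpos
  have h2 : (⨆ n : ℤ, a n) ≤ (bandUpper a b (m + 1) m - bandLower a b (m + 1) 0) / 2 :=
    ciSup_le fun n => by linarith [two_mul_le_spread ha hb hpos n]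
  have h3 : (bandUpper a b (m + 1) m - bandLower a b (m + 1) 0 - G) / 4 ≤ ⨅ n : ℤ, a n :=
    le_ciInf fun n => by linarith [spread_sub_le_sum_gaps ha hb hpos n]
  have h4 : (⨆ n : ℤ, b n) - G ≤ ⨅ n : ℤ, b n := le_ciInf fun t => by
    have : (⨆ n : ℤ, b n) ≤ b t + G := ciSup_le fun s => by linarith [sub_le_sum_gaps ha hb s t]
    linarith
  refine max_le ?_ (by linarith)
  have := max_le h1 (show (2 * ⨆ n : ℤ, a n) ≤ _ by linarith)
  linarith

end Bands

/-! ### Bloch decomposition of finitely supported sequences -/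

section Plancherel

open MeasureTheory AddCircle

variable {p : ℕ} {a b : ℤ → ℝ}

/-- Finite support makes the sum a trigonometric polynomial, so Parseval reduces to orthonormality
of the characters. -/
theorem integral_norm_sq_tsum_fourier {c : ℤ → ℂ} (hc : c.support.Finite) :
    ∫ t : UnitAddCircle, ‖∑' k : ℤ, c k * fourier (-k) t‖ ^ 2 ∂haarAddCircle =
      ∑' k : ℤ, ‖c k‖ ^ 2 := by
  set s := hc.toFinset with hs
  have hs0 : ∀ k ∉ s, c k = 0 := fun k hk => by simpa [hs] using hk
  have e1 : ∀ t : UnitAddCircle, ∑' k : ℤ, c k * fourier (-k) t =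
      (∑ k ∈ s, c k • fourier (-k) : C(UnitAddCircle, ℂ)) t := by
    intro t
    rw [tsum_eq_sum (s := s) fun k hk => by simp [hs0 k hk]]
    simp
  have e2 : ∑' k : ℤ, ‖c k‖ ^ 2 = ∑ k ∈ s, ‖c k‖ ^ 2 :=
    tsum_eq_sum fun k hk => by simp [hs0 k hk]
  have h1 := ContinuousMap.inner_toLp (𝕜 := ℂ) (haarAddCircle (T := (1 : ℝ)))
    (∑ k ∈ s, c k • fourier (-k)) (∑ k ∈ s, c k • fourier (-k))
  have h2 := (orthonormal_fourier (T := (1 : ℝ))).comp (fun k : ℤ => -k) neg_injective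
  have h3 := h2.inner_sum c c s
  simp only [map_sum, map_smul] at h1
  simp only [Function.comp_def, fourierLp] at h3
  rw [h3] at h1
  simp only [e1, e2]
  have h4 : ∀ z : ℂ, z * (starRingEnd ℂ) z = ((‖z‖ ^ 2 : ℝ) : ℂ) := fun z => by
    rw [Complex.mul_conj, Complex.normSq_eq_norm_sq]
  simp only [mul_comm ((starRingEnd ℂ) _), h4] at h1
  rw [integral_complex_ofReal] at h1
  exact_mod_cast h1.symm

/-- The Bloch sequence obtained by summing the translates of `y` by periods, with the multiplier
`fourier 1 t`. -/
noncomputable def blochSum (p : ℕ) (y : ℤ → ℂ) (t : UnitAddCircle) (n : ℤ) : ℂ :=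
  ∑' k : ℤ, y (n + k * p) * fourier (-k) t

theorem blochSum_isBloch (p : ℕ) (y : ℤ → ℂ) (t : UnitAddCircle) :
    IsBloch p (fourier 1 t) (blochSum p y t) := by
  intro n
  rw [blochSum, blochSum, ← tsum_mul_left, ← (Equiv.addRight (1 : ℤ)).tsum_eq
    fun k : ℤ => fourier 1 t * (y (n + k * p) * fourier (-k) t)]
  refine tsum_congr fun k => ?_
  simp only [Equiv.coe_addRight]
  rw [show n + (p : ℤ) + k * p = n + (k + 1) * p by ring,
    show -k = 1 + -(k + 1) by ring, fourier_add]
  ring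

section FiniteSupport

variable [NeZero p] {y : ℤ → ℂ}

theorem finite_support_period (hy : y.support.Finite) (n : ℤ) :
    (fun k : ℤ => y (n + k * p)).support.Finite := by
  have hp : (p : ℤ) ≠ 0 := by exact_mod_cast NeZero.ne p
  refine hy.preimage (f := fun k : ℤ => n + k * p) (fun k _ l _ h => ?_)
  exact mul_right_cancel₀ hp (add_left_cancel h)

theorem summable_blochSum (hy : y.support.Finite) (t : UnitAddCircle) (n : ℤ) :
    Summable fun k : ℤ => y (n + k * p) * fourier (-k) t :=
  summable_of_hasFiniteSupport
    ((finite_support_period hy n).subset (Function.support_mul_subset_left _ _))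

theorem continuous_blochSum (hy : y.support.Finite) (n : ℤ) :
    Continuous fun t => blochSum p y t n := by
  have h := finite_support_period (p := p) hy n
  have e : (fun t => blochSum p y t n) =
      fun t => ∑ k ∈ h.toFinset, y (n + k * p) * fourier (-k) t := by
    funext t
    refine tsum_eq_sum fun k hk => ?_
    have : y (n + k * p) = 0 := by simpa using hk
    simp [this]
  rw [e]
  fun_prop

theorem jacobiExpr_blochSum (ha : Function.Periodic a (p : ℤ)) (hb : Function.Periodic b (p : ℤ))
    (hy : y.support.Finite) (t : UnitAddCircle) (n : ℤ) :
    jacobiExpr a b (blochSum p y t) n = blochSum p (jacobiExpr a b y) t n := by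
  simp only [jacobiExpr, blochSum]
  rw [← tsum_mul_left, ← tsum_mul_left, ← tsum_mul_left,
    ← ((summable_blochSum hy t _).mul_left _).tsum_add ((summable_blochSum hy t _).mul_left _),
    ← (((summable_blochSum hy t _).mul_left _).add ((summable_blochSum hy t _).mul_left _)).tsum_add
      ((summable_blochSum hy t _).mul_left _)]
  refine tsum_congr fun k => ?_
  have h1 := ha.int_mul k (n - 1)
  have h2 := hb.int_mul k n
  have h3 := ha.int_mul k n
  simp only [Int.cast_id] at h1 h2 h3
  rw [show n + k * (p : ℤ) - 1 = n - 1 + k * p by ring,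
    show n + k * (p : ℤ) + 1 = n + 1 + k * p by ring, h1, h2, h3]
  ring

theorem sum_integral_blochSum (hy : y.support.Finite) :
    ∑ n ∈ Finset.range p, ∫ t, ‖blochSum p y t n‖ ^ 2 ∂haarAddCircle = ∑' n, ‖y n‖ ^ 2 := by
  have h1 : ∀ n : ℤ, ∫ t, ‖blochSum p y t n‖ ^ 2 ∂haarAddCircle =
      ∑' k : ℤ, ‖y (n + k * p)‖ ^ 2 := fun n =>
    integral_norm_sq_tsum_fourier (finite_support_period hy n)
  simp only [h1]
  have hs : Summable fun n => ‖y n‖ ^ 2 :=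
    summable_of_hasFiniteSupport (hy.subset fun n hn h => hn (by simp [h]))
  rw [← (Int.divModEquiv p).symm.tsum_eq]
  have hs' := (Int.divModEquiv p).symm.summable_iff.2 hs
  have hs'' := (Equiv.prodComm _ _).summable_iff.2 hs'
  have e := hs''.tsum_prod
  simp only [Function.comp_apply] at e
  rw [← (Equiv.prodComm _ _).tsum_eq, e, tsum_fintype, Finset.sum_range]
  refine Finset.sum_congr rfl fun i _ => tsum_congr fun k => ?_
  simp [Int.divModEquiv, add_comm]

theorem finite_support_jacobiExpr_sub (a b : ℤ → ℝ) (hy : y.support.Finite) (c : ℂ) :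
    (fun n => jacobiExpr a b y n - c * y n).support.Finite := by
  refine ((((hy.preimage (sub_left_injective (b := (1 : ℤ))).injOn).union hy).union
    (hy.preimage (add_left_injective (1 : ℤ)).injOn))).subset fun n hn => ?_
  by_contra h0
  simp only [Set.mem_union, Set.mem_preimage, Function.mem_support, not_or, not_not] at h0
  exact hn (by simp [jacobiExpr, h0])

theorem sum_blochSum_ge (ha : Function.Periodic a (p : ℤ)) (hb : Function.Periodic b (p : ℤ))
    (hy : y.support.Finite) {c δ : ℝ} (hδ : 0 ≤ δ)
    (h : ∀ s ∈ blochSpectrum a b p, δ ≤ |s - c|) (t : UnitAddCircle) :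
    δ ^ 2 * ∑ n ∈ Finset.range p, ‖blochSum p y t n‖ ^ 2 ≤
      ∑ n ∈ Finset.range p, ‖blochSum p (fun n => jacobiExpr a b y n - c * y n) t n‖ ^ 2 := by
  have hz : ‖fourier 1 t‖ = 1 := by rw [fourier_one]; exact Circle.norm_coe _
  have hz0 := ne_zero_of_norm_one hz
  set v : EuclideanSpace ℂ (Fin p) := WithLp.toLp 2 fun i => blochSum p y t ((i : ℕ) : ℤ) with hv
  have e : blochExt (fourier 1 t) v = blochSum p y t := (blochSum_isBloch p y t).blochExt_toLp hz0
  have h1 := norm_sub_smul_ge (floquet_isSymmetric (b := b) ha hz) (c := c) hδ (fun i hi => h _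
    ⟨_, hz, exists_isBloch_ascEigenvalue_floquet ha hb hz (by simpa using hi)⟩) v
  rw [norm_sq_eq_sum_blochExt (fourier 1 t) v, e, EuclideanSpace.norm_sq_eq] at h1
  refine h1.trans_eq ?_
  rw [Finset.sum_range]
  refine Finset.sum_congr rfl fun i _ => ?_
  congr 2
  change jacobiExpr a b (blochExt (fourier 1 t) v) _ - (c : ℂ) * blochSum p y t _ = _
  rw [e, jacobiExpr_blochSum ha hb hy, blochSum, blochSum, blochSum, ← tsum_mul_left,
    ← Summable.tsum_sub]
  · exact tsum_congr fun k => by ring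
  · exact summable_blochSum (by simpa using finite_support_jacobiExpr_sub a b hy 0) t _
  · exact (summable_blochSum hy t _).mul_left _

/-- The fibrewise bound has a constant `δ` independent of `t`; integrating it over the circle turns
both sides into `ℓ²` norms. -/
theorem tsum_norm_sq_jacobiExpr_sub_ge (ha : Function.Periodic a (p : ℤ))
    (hb : Function.Periodic b (p : ℤ)) (hy : y.support.Finite) {c δ : ℝ} (hδ : 0 ≤ δ)
    (h : ∀ s ∈ blochSpectrum a b p, δ ≤ |s - c|) :
    δ ^ 2 * ∑' n, ‖y n‖ ^ 2 ≤ ∑' n, ‖jacobiExpr a b y n - c * y n‖ ^ 2 := by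
  have hy' := finite_support_jacobiExpr_sub a b hy c
  have hint : ∀ {x : ℤ → ℂ}, x.support.Finite → ∀ n : ℤ,
      Integrable (fun t => ‖blochSum p x t n‖ ^ 2) haarAddCircle := fun hx n =>
    ((continuous_blochSum hx n).norm.pow 2).integrable_of_hasCompactSupport
      (HasCompactSupport.of_compactSpace _)
  rw [← sum_integral_blochSum (p := p) hy, ← sum_integral_blochSum (p := p) hy',
    ← integral_finsetSum _ fun n _ => hint hy _, ← integral_finsetSum _ fun n _ => hint hy' _,
    ← integral_const_mul]
  exact integral_mono ((integrable_finsetSum _ fun n _ => hint hy _).const_mul _)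
    (integrable_finsetSum _ fun n _ => hint hy' _) fun t => sum_blochSum_ge ha hb hy hδ h t

end FiniteSupport

end Plancherel

/-! ### The spectrum on `ℓ²(ℤ)` equals the Bloch spectrum -/

section Spectrum

variable {p : ℕ} (hp : 1 ≤ p) {a b : ℤ → ℝ} (ha : Function.Periodic a (p : ℤ))
  (hb : Function.Periodic b (p : ℤ))

theorem L2Z.hasSum_norm_sq (y : L2Z) : HasSum (fun n => ‖y n‖ ^ 2) (‖y‖ ^ 2) := by
  have h := lp.hasSum_norm (p := 2) (by norm_num) y
  simpa using h

theorem jacobi_isSelfAdjoint : IsSelfAdjoint (jacobi hp ha hb) := by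
  rw [ContinuousLinearMap.isSelfAdjoint_iff_isSymmetric]
  intro x y
  obtain ⟨A, hA, hA'⟩ := periodic_bounded hp ha
  obtain ⟨B, hB, hB'⟩ := periodic_bounded hp hb
  have key : ∀ x y : L2Z, Summable fun n : ℤ =>
      (starRingEnd ℂ) (x n) * ((a n : ℂ) * y (n + 1)) := by
    intro x y
    obtain ⟨h, -⟩ := shiftMul_bound hA hA' 1 y
    have := lp.summable_inner (𝕜 := ℂ) x (⟨_, h⟩ : L2Z)
    simpa [mul_comm] using this
  have hBs : Summable fun n : ℤ => (starRingEnd ℂ) (x n) * ((b n : ℂ) * y n) := by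
    obtain ⟨h, -⟩ := shiftMul_bound hB hB' 0 y
    have := lp.summable_inner (𝕜 := ℂ) x (⟨_, h⟩ : L2Z)
    simpa [mul_comm] using this
  have h1 := (key x y).hasSum
  have h2 := (key y x).hasSum.mapL Complex.conjCLE.toContinuousLinearMap
  simp only [ContinuousLinearEquiv.coe_coe, Complex.conjCLE_apply, map_mul, Complex.conj_conj,
    Complex.conj_ofReal] at h2
  have h1' := (Equiv.subRight (1 : ℤ)).hasSum_iff.2 h1
  have h2' := (Equiv.subRight (1 : ℤ)).hasSum_iff.2 h2
  have e1 := lp.hasSum_inner (𝕜 := ℂ) (jacobi hp ha hb x) y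
  have e2 := lp.hasSum_inner (𝕜 := ℂ) x (jacobi hp ha hb y)
  -- The two inner products differ only in which coupling series has its index shifted by one, so
  -- they share the value `V`.
  obtain ⟨V, s1, s2⟩ : ∃ V, HasSum _ V ∧ HasSum _ V :=
    ⟨_, (h1'.add hBs.hasSum).add h2, (h1.add hBs.hasSum).add h2'⟩
  refine (e1.unique (a₂ := V) ?_).trans (e2.unique (a₂ := V) ?_).symm
  · convert! s1 using 1
    funext n
    simp only [jacobi_apply, RCLike.inner_apply, Function.comp_apply, Equiv.subRight_apply,
      sub_add_cancel, map_add, map_mul, Complex.conj_ofReal]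
    ring
  · convert! s2 using 1
    funext n
    simp only [jacobi_apply, RCLike.inner_apply, Function.comp_apply, Equiv.subRight_apply,
      sub_add_cancel]
    ring

/-- The bound gives injectivity and closed range; self-adjointness identifies the orthogonal
complement of the range with the trivial kernel. -/
theorem isUnit_of_bounded_below {E : Type*} [NormedAddCommGroup E] [InnerProductSpace ℂ E]
    [CompleteSpace E] {T : E →L[ℂ] E} (hT : IsSelfAdjoint T) {δ : ℝ} (hδ : 0 < δ)
    (h : ∀ x, δ * ‖x‖ ≤ ‖T x‖) : IsUnit T := by
  rw [ContinuousLinearMap.isUnit_iff_bijective,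
    ContinuousLinearMap.bijective_iff_dense_range_and_antilipschitz]
  have hanti : AntilipschitzWith (⟨δ⁻¹, by positivity⟩ : NNReal) T :=
    T.antilipschitz_of_bound fun x => by
      change ‖x‖ ≤ δ⁻¹ * ‖T x‖
      rw [inv_mul_eq_div, le_div_iff₀ hδ, mul_comm]
      exact h x
  refine ⟨?_, _, hanti⟩
  rw [Submodule.topologicalClosure_eq_top_iff, ContinuousLinearMap.orthogonal_range,
    show ContinuousLinearMap.adjoint T = T from hT]
  exact LinearMap.ker_eq_bot.2 hanti.injective

theorem jacobi_sub_bounded_below {c δ : ℝ} (hδ : 0 ≤ δ)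
    (h : ∀ s ∈ blochSpectrum a b p, δ ≤ |s - c|) (x : L2Z) :
    δ * ‖x‖ ≤ ‖(jacobi hp ha hb - algebraMap ℂ (L2Z →L[ℂ] L2Z) c) x‖ := by
  have : NeZero p := ⟨by omega⟩
  set T := jacobi hp ha hb - algebraMap ℂ (L2Z →L[ℂ] L2Z) c with hT
  have hTn : ∀ (y : L2Z) n, T y n = jacobiExpr a b y n - c * y n := fun y n => rfl
  have key : ∀ y : L2Z, (Function.support y).Finite → δ * ‖y‖ ≤ ‖T y‖ := by
    intro y hy
    have h1 := tsum_norm_sq_jacobiExpr_sub_ge ha hb hy hδ h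
    rw [(L2Z.hasSum_norm_sq y).tsum_eq] at h1
    have h2 := (L2Z.hasSum_norm_sq (T y)).tsum_eq
    simp only [hTn] at h2
    rw [h2, ← mul_pow] at h1
    exact le_of_sq_le_sq h1 (norm_nonneg _)
  -- Finitely supported sequences are dense, and both sides of the bound are continuous.
  have hs := lp.hasSum_single (p := 2) (by norm_num) x
  have hlim := (T.continuous.norm.tendsto x).comp hs
  have hlim' := ((continuous_norm.tendsto x).comp hs).const_mul δ
  refine le_of_tendsto_of_tendsto' hlim' hlim fun s => key _ ?_
  refine s.finite_toSet.subset fun n hn => ?_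
  by_contra h0
  apply hn
  rw [lp.coeFn_sum, Finset.sum_apply]
  refine Finset.sum_eq_zero fun i hi => ?_
  rw [lp.single_apply, Pi.single_apply, if_neg]
  rintro rfl
  exact h0 hi

theorem mem_blochSpectrum_of_mem_spectrum (hcl : IsClosed (blochSpectrum a b p)) {c : ℂ}
    (hc : c ∈ spectrum ℂ (jacobi hp ha hb)) : ∃ r ∈ blochSpectrum a b p, (r : ℂ) = c := by
  have hre := (jacobi_isSelfAdjoint hp ha hb).mem_spectrum_eq_re hc
  refine ⟨c.re, ?_, hre.symm⟩
  by_contra hnot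
  obtain ⟨δ, hδ, hball⟩ := Metric.isOpen_iff.1 hcl.isOpen_compl c.re hnot
  rw [hre, spectrum.mem_iff, IsUnit.sub_iff] at hc
  refine hc (isUnit_of_bounded_below ?_ hδ
    (jacobi_sub_bounded_below hp ha hb hδ.le fun s hs => ?_))
  · refine (jacobi_isSelfAdjoint hp ha hb).sub (IsSelfAdjoint.algebraMap _ ?_)
    exact Complex.conj_ofReal _
  · by_contra! hlt
    exact hball (by rwa [Metric.mem_ball, Real.dist_eq]) hs

/-- Truncations of a Bloch solution are approximate eigenvectors. -/
theorem mem_spectrum_of_mem_blochSpectrum {c : ℝ} (hc : c ∈ blochSpectrum a b p) :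
    (c : ℂ) ∈ spectrum ℂ (jacobi hp ha hb) := by
  have : NeZero p := ⟨by omega⟩
  obtain ⟨z, hz, y, hy0, hy, hyc⟩ := hc
  rw [spectrum.mem_iff, IsUnit.sub_iff]
  intro hunit
  set T := jacobi hp ha hb - algebraMap ℂ (L2Z →L[ℂ] L2Z) c with hT
  have hTn : ∀ (x : L2Z) n, T x n = jacobiExpr a b x n - c * x n := fun x n => rfl
  obtain ⟨K, hK⟩ := ((T.bijective_iff_dense_range_and_antilipschitz).1
    (ContinuousLinearMap.isUnit_iff_bijective.1 hunit)).2
  obtain ⟨A, hA, hA'⟩ := periodic_bounded hp ha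
  obtain ⟨Y, hY, hY'⟩ := periodic_bounded hp (hy.norm_periodic hz)
  simp only [abs_norm] at hY'
  obtain ⟨n₀, hn₀⟩ : ∃ n, y n ≠ 0 := Function.ne_iff.1 hy0
  -- Cut the Bloch solution off to `N` periods: its squared norm grows at least like `N`, while its
  -- image under `T` lives on at most four sites near the ends of the window and is bounded there.
  -- An inverse with constant `K` would bound `N`.
  have hmain : ∀ N : ℕ, (N : ℝ) * ‖y n₀‖ ^ 2 ≤ (K : ℝ) ^ 2 * (4 * (2 * (A * Y)) ^ 2) := by
    intro N
    set I : Finset ℤ := Finset.Ico n₀ (n₀ + N * p) with hI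
    set χ : ℤ → ℂ := fun n => if n ∈ I then 1 else 0 with hχ
    have hχ1 : ∀ n m, ‖χ n - χ m‖ ≤ 1 := fun n m => by
      simp only [hχ]; split_ifs <;> simp
    set f : ℤ → ℂ := fun n => χ n * y n with hf
    have hfs : ∀ n ∉ I, f n = 0 := fun n hn => by simp [hf, hχ, hn]
    have hmem : Memℓp f 2 := by
      refine memℓp_gen (summable_of_hasFiniteSupport (I.finite_toSet.subset fun n hn => ?_))
      by_contra h0
      exact hn (by simp [hfs n h0])
    set x : L2Z := ⟨f, hmem⟩ with hx
    have hxn : ∀ n, x n = f n := fun n => rfl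
    have hTx : ∀ n, T x n = (a (n - 1) : ℂ) * ((χ (n - 1) - χ n) * y (n - 1)) +
        (a n : ℂ) * ((χ (n + 1) - χ n) * y (n + 1)) := by
      intro n
      have h1 := hyc n
      rw [hTn]
      simp only [jacobiExpr, hxn, hf] at h1 ⊢
      linear_combination χ n * h1
    have hTle : ∀ n, ‖T x n‖ ≤ 2 * (A * Y) := by
      intro n
      have hterm : ∀ k l m : ℤ, ‖(a k : ℂ) * ((χ l - χ m) * y l)‖ ≤ A * Y := by
        intro k l m
        rw [norm_mul, norm_mul, Complex.norm_real, Real.norm_eq_abs]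
        have h1 : ‖χ l - χ m‖ * ‖y l‖ ≤ Y :=
          (mul_le_of_le_one_left (norm_nonneg _) (hχ1 l m)).trans (hY' l)
        exact mul_le_mul (hA' k) h1 (by positivity) hA
      rw [hTx, two_mul]
      exact (norm_add_le _ _).trans (add_le_add (hterm _ _ _) (hterm _ _ _))
    set S : Finset ℤ := {n₀ - 1, n₀, n₀ + N * p - 1, n₀ + N * p} with hS
    have hTS : ∀ n ∉ S, T x n = 0 := by
      intro n hn
      simp only [hS, Finset.mem_insert, Finset.mem_singleton, not_or] at hn
      have h1 : χ (n - 1) = χ n := by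
        have : n - 1 ∈ I ↔ n ∈ I := by simp only [hI, Finset.mem_Ico]; omega
        simp only [hχ, this]
      have h2 : χ (n + 1) = χ n := by
        have : n + 1 ∈ I ↔ n ∈ I := by simp only [hI, Finset.mem_Ico]; omega
        simp only [hχ, this]
      rw [hTx, h1, h2]
      simp
    have hTnorm : ‖T x‖ ^ 2 ≤ 4 * (2 * (A * Y)) ^ 2 := by
      rw [← (L2Z.hasSum_norm_sq (T x)).tsum_eq,
        tsum_eq_sum (s := S) fun n hn => by simp [hTS n hn]]
      refine (Finset.sum_le_card_nsmul _ _ ((2 * (A * Y)) ^ 2) fun n _ =>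
        pow_le_pow_left₀ (norm_nonneg _) (hTle n) 2).trans ?_
      rw [nsmul_eq_mul]
      refine mul_le_mul_of_nonneg_right ?_ (sq_nonneg _)
      exact_mod_cast (Finset.card_insert_le _ _).trans (Nat.succ_le_succ
        ((Finset.card_insert_le _ _).trans (Nat.succ_le_succ (Finset.card_le_two))))
    have hxnorm : (N : ℝ) * ‖y n₀‖ ^ 2 ≤ ‖x‖ ^ 2 := by
      have hinj : Function.Injective fun k : ℕ => n₀ + (k : ℤ) * p := by
        intro k l h
        have hp0 : (p : ℤ) ≠ 0 := by exact_mod_cast NeZero.ne p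
        exact_mod_cast mul_right_cancel₀ hp0 (add_left_cancel h)
      have h1 := sum_le_hasSum ((Finset.range N).image fun k : ℕ => n₀ + (k : ℤ) * p)
        (fun n _ => sq_nonneg _) (L2Z.hasSum_norm_sq x)
      rw [Finset.sum_image hinj.injOn] at h1
      refine le_trans (le_of_eq ?_) h1
      rw [Finset.sum_congr rfl (g := fun _ => ‖y n₀‖ ^ 2) fun k hk => ?_]
      · simp
      · have hk := Finset.mem_range.1 hk
        have hmemI : n₀ + (k : ℤ) * p ∈ I := by
          simp only [hI, Finset.mem_Ico]
          have hp0 : (0 : ℤ) < p := by exact_mod_cast NeZero.pos p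
          constructor
          · nlinarith
          · have : (k : ℤ) < N := by exact_mod_cast hk
            nlinarith
        rw [hxn]
        simp only [hf, hχ, hmemI, if_true, one_mul]
        rw [hy.add_mul_period (ne_zero_of_norm_one hz), norm_mul, norm_zpow, hz]
        simp
    have h3 : ‖x‖ ≤ K * ‖T x‖ := by
      have := hK.le_mul_dist x 0
      simpa using this
    calc (N : ℝ) * ‖y n₀‖ ^ 2 ≤ ‖x‖ ^ 2 := hxnorm
      _ ≤ (K * ‖T x‖) ^ 2 := pow_le_pow_left₀ (norm_nonneg _) h3 2
      _ = (K : ℝ) ^ 2 * ‖T x‖ ^ 2 := mul_pow _ _ _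
      _ ≤ _ := mul_le_mul_of_nonneg_left hTnorm (sq_nonneg _)
  have hpos : 0 < ‖y n₀‖ ^ 2 := by positivity
  obtain ⟨N, hN⟩ := exists_nat_gt ((K : ℝ) ^ 2 * (4 * (2 * (A * Y)) ^ 2) / ‖y n₀‖ ^ 2)
  rw [div_lt_iff₀ hpos] at hN
  exact absurd (hmain N) (not_le.2 hN)

theorem spectrum_jacobi_eq (hcl : IsClosed (blochSpectrum a b p)) :
    spectrum ℂ (jacobi hp ha hb) = ((↑) : ℝ → ℂ) '' blochSpectrum a b p := by
  ext c
  constructor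
  · exact mem_blochSpectrum_of_mem_spectrum hp ha hb hcl
  · rintro ⟨r, hr, rfl⟩
    exact mem_spectrum_of_mem_blochSpectrum hp ha hb hr

end Spectrum

/-! ### Independence of the chosen bands, and the theorem -/

section BandDecomposition

open MeasureTheory

/-- The total length of the gaps of a finite union of consecutive intervals is determined by the
union. -/
theorem sum_gaps_eq_sSup_sub {m : ℕ} {l u : ℕ → ℝ} (hlt : ∀ i < m + 1, l i < u i)
    (hle : ∀ i, i + 1 < m + 1 → u i ≤ l (i + 1)) {S : Set ℝ}
    (hS : S = ⋃ i ∈ Finset.range (m + 1), Set.Icc (l i) (u i)) :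
    ∑ i ∈ Finset.range m, (l (i + 1) - u i) = sSup S - sInf S - volume.real S := by
  have hmono : ∀ i j, i < j → j < m + 1 → u i ≤ l j := by
    intro i j hij
    induction j, hij using Nat.le_induction with
    | base => exact fun hj => hle i hj
    | succ j hij ih =>
      intro hj
      exact (ih (by omega)).trans ((hlt j (by omega)).le.trans (hle j hj))
  have hmem : ∀ i < m + 1, Set.Icc (l i) (u i) ⊆ S := by
    intro i hi
    rw [hS]
    exact Set.subset_biUnion_of_mem (u := fun i => Set.Icc (l i) (u i)) (Finset.mem_range.2 hi)
  have hex : ∀ c ∈ S, ∃ i < m + 1, c ∈ Set.Icc (l i) (u i) := by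
    intro c hc
    simpa only [hS, Set.mem_iUnion, Finset.mem_range, exists_prop] using hc
  have hmax : IsGreatest S (u m) := by
    refine ⟨hmem m (by omega) ⟨(hlt m (by omega)).le, le_rfl⟩, fun c hc => ?_⟩
    obtain ⟨i, hi, hci⟩ := hex c hc
    rcases (Nat.lt_succ_iff.1 hi).eq_or_lt with rfl | him
    · exact hci.2
    · exact hci.2.trans ((hmono i m him (by omega)).trans (hlt m (by omega)).le)
  have hmin : IsLeast S (l 0) := by
    refine ⟨hmem 0 (by omega) ⟨le_rfl, (hlt 0 (by omega)).le⟩, fun c hc => ?_⟩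
    obtain ⟨i, hi, hci⟩ := hex c hc
    rcases Nat.eq_zero_or_pos i with rfl | h0
    · exact hci.1
    · exact ((hlt 0 (by omega)).le.trans (hmono 0 i h0 hi)).trans hci.1
  have hvol : volume.real S = ∑ i ∈ Finset.range (m + 1), (u i - l i) := by
    rw [hS, measureReal_biUnion_finset₀ _ _ fun i _ => measure_Icc_lt_top.ne]
    · refine Finset.sum_congr rfl fun i hi => ?_
      rw [Real.volume_real_Icc_of_le (hlt i (Finset.mem_range.1 hi)).le]
    · have key : ∀ i j, i < j → j < m + 1 →
          AEDisjoint volume (Set.Icc (l i) (u i)) (Set.Icc (l j) (u j)) := by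
        intro i j hij hj
        -- Touching bands share at most an endpoint, so degenerate gaps do not affect the measure.
        refine measure_mono_null (t := {u i}) (fun c hc => ?_) Real.volume_singleton
        exact le_antisymm hc.1.2 ((hmono i j hij hj).trans hc.2.1)
      intro i hi j hj hij
      rcases hij.lt_or_gt with h | h
      · exact key i j h (Finset.mem_range.1 hj)
      · exact (key j i h (Finset.mem_range.1 hi)).symm
    · exact fun i _ => measurableSet_Icc.nullMeasurableSet
  rw [sum_gaps_eq, hmax.csSup_eq, hmin.csInf_eq, hvol]

end BandDecomposition

theorem mainTheorem2 (p : ℕ) (hp : 1 ≤ p) (a b : ℤ → ℝ)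
    (ha : Function.Periodic a (p : ℤ)) (hb : Function.Periodic b (p : ℤ))
    (hpos : ∀ n, 0 < a n) :
    (∃ l u : ℕ → ℝ, IsBandDecomposition (jacobi hp ha hb) p l u) ∧
    ∀ l u : ℕ → ℝ, IsBandDecomposition (jacobi hp ha hb) p l u →
      max
        (max (4 * (∏ n ∈ Finset.Icc 1 p, a (n : ℤ)) ^ (1 / (p : ℝ))) (2 * ⨆ n : ℤ, a n)
          - 4 * ⨅ n : ℤ, a n)
        ((⨆ n : ℤ, b n) - ⨅ n : ℤ, b n)
      ≤ ∑ i ∈ Finset.range (p - 1), MeasureTheory.volume.real (bandGap l u i) := by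
  obtain ⟨m, rfl⟩ : ∃ m, p = m + 1 := ⟨p - 1, by omega⟩
  have hS := blochSpectrum_eq ha hb hpos
  have hcl : IsClosed (blochSpectrum a b (m + 1)) := by
    rw [hS]
    exact isClosed_biUnion_finset fun i _ => isClosed_Icc
  have hspec := spectrum_jacobi_eq hp ha hb hcl
  have hlt : ∀ i < m + 1, bandLower a b (m + 1) i < bandUpper a b (m + 1) i :=
    fun i hi => bandLower_lt_bandUpper ha hb hpos hi
  have hle : ∀ i, i + 1 < m + 1 → bandUpper a b (m + 1) i ≤ bandLower a b (m + 1) (i + 1) :=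
    fun i hi => bandUpper_le_bandLower_succ ha b (by omega)
  refine ⟨⟨bandLower a b (m + 1), bandUpper a b (m + 1), hlt, hle, by rw [hspec, hS]⟩,
    fun l u h => ?_⟩
  have hS' : blochSpectrum a b (m + 1) = ⋃ i ∈ Finset.range (m + 1), Set.Icc (l i) (u i) :=
    Complex.ofReal_injective.image_injective (hspec.symm.trans h.spectrum_eq)
  have hgap : ∑ i ∈ Finset.range m, MeasureTheory.volume.real (bandGap l u i) =
      ∑ i ∈ Finset.range m, (l (i + 1) - u i) := Finset.sum_congr rfl fun i hi =>
    Real.volume_real_Ioo_of_le (h.le i (by have := Finset.mem_range.1 hi; omega))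
  -- The given bands and the Floquet bands have the same union, and the total gap length depends
  -- only on that union, so the bands need not be matched one by one.
  rw [Nat.add_sub_cancel, hgap, sum_gaps_eq_sSup_sub h.lt h.le hS',
    ← sum_gaps_eq_sSup_sub hlt hle hS]
  exact max_le_sum_gaps ha hb hpos
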